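/- **Setting.** $\|\cdot\|$ is the Euclidean norm of vectors and the induced operator norm of matrices; $\lambda_{\max},\lambda_{\min}$ are the largest and smallest eigenvalue of a symmetric matrix. There are $N$ agents with a distance function $\mathrm{dist}:[N]\times[N]\to\mathbb R_{\ge 0}$ (zero on the diagonal, symmetric, triangle inequality), and $D$ is a number with $\mathrm{dist}(i,j)\le D$ for all $i,j$; for the graph distance of a connected graph on the $N$ agents one may take $D=N$. States $x=[x^1;\dots;x^N]$ and controls $u=[u^1;\dots;u^N]$ are stacked from local vectors, and $[X]_{ij}$ is the block of $X$ with the rows of agent $i$ and the columns of agent $j$. A matrix $X$ is $(c,\gamma)$-spatially exponentially decaying (SED) if $\|[X]_{ij}\|\le c\,e^{-\gamma\,\mathrm{dist}(i,j)}$ for all $i,j$, and a square matrix $X$ is $(\tau,e^{-\rho})$-stable, where $\tau\ge1$ and $\rho>0$, if $\|X^k\|\le\tau e^{-\rho k}$ for all $k\ge0$. The LQR problem is to minimize $$\limsup_{T\to\infty}\frac1T\,\mathbb E\sum_{t=0}^{T-1}\bigl(x_t^\top Qx_t+u_t^\top Ru_t+2u_t^\top Sx_t\bigr),\qquad x_{t+1}=Ax_t+Bu_t+w_t,$$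 over all causal controls, where $w_t\sim\mathcal N(0,I)$ are independent and $x_0$ is a fixed deterministic vector. An optimal gain is a matrix $K$ such that $u_t=-Kx_t$ attains the minimum. **Theorem.** Assume $Q\succ0$, $R-SQ^{-1}S^\top\succ0$, that $A,B,Q,R,S$ are $(a,\gamma_{\rm sys})$-, $(b,\gamma_{\rm sys})$-, $(q,\gamma_{\rm sys})$-, $(r,\gamma_{\rm sys})$-, $(s,\gamma_{\rm sys})$-SED respectively with $\gamma_{\rm sys}>0$, $a,b,q,r\ge1$, $s>0$, and that $A$ is asymptotically stable ($A^k\to0$). Let $K$ be an optimal gain of the LQR problem. Then there are $\tau\ge1$, $\rho>0$ such that both $A$ and $A-BK$ are $(\tau,e^{-\rho})$-stable; and for all such $\tau,\rho$ the gain $K$ is $(c_K,\gamma_K)$-SED, where, with $\underline\lambda=\lambda_{\min}(R-SQ^{-1}S^\top)$, $$c_K=\frac{2\tau^3(\|B\|^2\|K\|\|Q\|+\|B\|\|K\|\|S\|)}{(1-e^{-2\rho})^{5/2}\,\underline\lambda}+\frac{2\tau^2(\|B\|\|Q\|+\|S\|)}{(1-e^{-2\rho})^2\,\underline\lambda}+2c_J,$$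 $$\gamma_K=\frac{\gamma_{\rm sys}\,\rho\,\underline\lambda}{\rho+\ln(aN)}\cdot\frac{1}{\max\Bigl\{1,\ \lambda_{\max}(R)+\frac{4\tau^2(\|B\|^2\|Q\|+\|B\|\|S\|)}{(1-e^{-2\rho})^2}\Bigr\}\ln\bigl(\gamma_{\rm sys}c_MND+c_MN+1\bigr)+\underline\lambda},$$ $$c_J=bN\Bigl(\frac{\tau^2\|Q\|}{1-e^{-2\rho}}+2q\Bigr)+s+\tau\|S\|,\qquad c_M=b^2N^2\Bigl(\frac{\tau^2\|Q\|}{1-e^{-2\rho}}+2q\Bigr)+bN(s+\tau\|S\|)+r.$$ -/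

import Mathlib

open MeasureTheory ProbabilityTheory Filter Topology Matrix
open scoped ENNReal Matrix.Norms.L2Operator

/-- A distance function on the set of the `N` agents. -/
structure IsAgentDistance {N : ℕ} (d : Fin N → Fin N → ℝ) : Prop where
  nonneg : ∀ i j, 0 ≤ d i j
  self : ∀ i, d i i = 0
  symm : ∀ i j, d i j = d j i
  triangle : ∀ i j k, d i j ≤ d i k + d k j

/-- Coordinates of the stacked vector `[v¹; …; vᴺ]`, where `vⁱ` has dimension `n i`. -/
abbrev BlockIdx {N : ℕ} (n : Fin N → ℕ) : Type := (i : Fin N) × Fin (n i)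

/-- The block `[X]ᵢⱼ` of a matrix `X`: rows of agent `i`, columns of agent `j`. -/
def blockOf {N : ℕ} {n m : Fin N → ℕ} (X : Matrix (BlockIdx n) (BlockIdx m) ℝ) (i j : Fin N) :
    Matrix (Fin (n i)) (Fin (m j)) ℝ :=
  X.submatrix (fun k => ⟨i, k⟩) (fun l => ⟨j, l⟩)

/-- `X` is `(c, γ)`-spatially exponentially decaying with respect to `d`. The norm is the operator
norm induced by the Euclidean norms. -/
def IsSED {N : ℕ} {n m : Fin N → ℕ} (d : Fin N → Fin N → ℝ)
    (X : Matrix (BlockIdx n) (BlockIdx m) ℝ) (c γ : ℝ) : Prop :=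
  ∀ i j, ‖blockOf X i j‖ ≤ c * Real.exp (-γ * d i j)

/-- `X` is `(τ, e^{-ρ})`-stable (used with `τ ≥ 1` and `ρ > 0`). -/
def IsExpStable {n : Type*} [Fintype n] [DecidableEq n] (X : Matrix n n ℝ) (τ ρ : ℝ) : Prop :=
  ∀ k : ℕ, ‖X ^ k‖ ≤ τ * Real.exp (-ρ * k)

/-- The largest eigenvalue of a symmetric real matrix. -/
noncomputable def lambdaMax {n : Type*} [Fintype n] [DecidableEq n] (X : Matrix n n ℝ) : ℝ :=
  sSup (spectrum ℝ X)

/-- The smallest eigenvalue of a symmetric real matrix. -/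
noncomputable def lambdaMin {n : Type*} [Fintype n] [DecidableEq n] (X : Matrix n n ℝ) : ℝ :=
  sInf (spectrum ℝ X)

section LQR

variable {n m Ω : Type*} [Fintype n] [Fintype m]

/-- `w 0, w 1, …` are independent random vectors with law `N(0, I)`. -/
structure IsStandardGaussianNoise [MeasurableSpace Ω] (μ : Measure Ω) (w : ℕ → Ω → (n → ℝ)) :
    Prop where
  measurable : ∀ t, Measurable (w t)
  indep : iIndepFun w μ
  law : ∀ t, μ.map (w t) = Measure.pi (fun _ : n => gaussianReal 0 1)

/-- The state of `x_{t+1} = A x_t + B u_t + w_t` started at the deterministic vector `x₀`. -/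
def lqrState (A : Matrix n n ℝ) (B : Matrix n m ℝ) (x₀ : n → ℝ) (w : ℕ → Ω → (n → ℝ))
    (u : ℕ → Ω → (m → ℝ)) : ℕ → Ω → (n → ℝ)
  | 0, _ => x₀
  | t + 1, ω => A *ᵥ lqrState A B x₀ w u t ω + B *ᵥ u t ω + w t ω

/-- The state under the feedback `u_t = -K x_t`, that is `x_{t+1} = A x_t + B (-K x_t) + w_t`. -/
def feedbackState (A : Matrix n n ℝ) (B : Matrix n m ℝ) (K : Matrix m n ℝ) (x₀ : n → ℝ)
    (w : ℕ → Ω → (n → ℝ)) : ℕ → Ω → (n → ℝ)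
  | 0, _ => x₀
  | t + 1, ω => A *ᵥ feedbackState A B K x₀ w t ω
      + B *ᵥ (-(K *ᵥ feedbackState A B K x₀ w t ω)) + w t ω

/-- Causality: `u t` is a measurable function of `w 0, …, w (t - 1)` (equivalently, as `x₀` is
deterministic, of the states and controls before the choice of `u t`). -/
def IsCausalControl (w : ℕ → Ω → (n → ℝ)) (u : ℕ → Ω → (m → ℝ)) : Prop :=
  ∀ t, Measurable[⨆ s : Fin t, MeasurableSpace.comap (w s) inferInstance] (u t)

/-- The stage cost `xᵀ Q x + uᵀ R u + 2 uᵀ S x`. -/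
def stageCost (Q : Matrix n n ℝ) (R : Matrix m m ℝ) (S : Matrix m n ℝ) (x : n → ℝ) (u : m → ℝ) :
    ℝ :=
  x ⬝ᵥ Q *ᵥ x + u ⬝ᵥ R *ᵥ u + 2 * (u ⬝ᵥ S *ᵥ x)

/-- The long-run average expected cost `limsup (1 / T) 𝔼 ∑_{t < T} cost_t`, with values in
`[0, ∞]`. It is used only where the stage cost is nonnegative (`Q ≻ 0`, `R - S Q⁻¹ Sᵀ ≻ 0`). -/
noncomputable def averageCost [MeasurableSpace Ω] (μ : Measure Ω) (Q : Matrix n n ℝ)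
    (R : Matrix m m ℝ) (S : Matrix m n ℝ) (x : ℕ → Ω → (n → ℝ)) (u : ℕ → Ω → (m → ℝ)) : ℝ≥0∞ :=
  limsup (fun T : ℕ => (T : ℝ≥0∞)⁻¹ *
    ∑ t ∈ Finset.range T, ∫⁻ ω, ENNReal.ofReal (stageCost Q R S (x t ω) (u t ω)) ∂μ) atTop

/-- `K` is an optimal gain of the LQR problem: the feedback `u_t = -K x_t` minimizes the average
cost among all causal controls. -/
def IsOptimalGain [MeasurableSpace Ω] (μ : Measure Ω) (w : ℕ → Ω → (n → ℝ)) (x₀ : n → ℝ)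
    (A : Matrix n n ℝ) (B : Matrix n m ℝ) (Q : Matrix n n ℝ) (R : Matrix m m ℝ)
    (S : Matrix m n ℝ) (K : Matrix m n ℝ) : Prop :=
  ∀ u : ℕ → Ω → (m → ℝ), IsCausalControl w u →
    averageCost μ Q R S (feedbackState A B K x₀ w)
        (fun t ω => -(K *ᵥ feedbackState A B K x₀ w t ω)) ≤
      averageCost μ Q R S (lqrState A B x₀ w u) u

end LQR

section Constants

variable {n m : Type*} [Fintype n] [DecidableEq n] [Fintype m] [DecidableEq m]

/-- The constant `c_J`. -/
noncomputable def constJ (N : ℕ) (b q s τ ρ : ℝ) (Q : Matrix n n ℝ) (S : Matrix m n ℝ) : ℝ :=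
  b * N * (τ ^ 2 * ‖Q‖ / (1 - Real.exp (-2 * ρ)) + 2 * q) + s + τ * ‖S‖

/-- The constant `c_M`. -/
noncomputable def constM (N : ℕ) (b q r s τ ρ : ℝ) (Q : Matrix n n ℝ) (S : Matrix m n ℝ) : ℝ :=
  b ^ 2 * N ^ 2 * (τ ^ 2 * ‖Q‖ / (1 - Real.exp (-2 * ρ)) + 2 * q)
    + b * N * (s + τ * ‖S‖) + r

/-- The constant `c_K`. -/
noncomputable def constK (N : ℕ) (b q s τ ρ : ℝ) (B : Matrix n m ℝ) (Q : Matrix n n ℝ)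
    (R : Matrix m m ℝ) (S : Matrix m n ℝ) (K : Matrix m n ℝ) : ℝ :=
  2 * τ ^ 3 * (‖B‖ ^ 2 * ‖K‖ * ‖Q‖ + ‖B‖ * ‖K‖ * ‖S‖) /
      ((1 - Real.exp (-2 * ρ)) ^ (5 / 2 : ℝ) * lambdaMin (R - S * Q⁻¹ * Sᵀ))
    + 2 * τ ^ 2 * (‖B‖ * ‖Q‖ + ‖S‖) /
      ((1 - Real.exp (-2 * ρ)) ^ 2 * lambdaMin (R - S * Q⁻¹ * Sᵀ))
    + 2 * constJ N b q s τ ρ Q S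

/-- The rate `γ_K`, for agents whose mutual distances are at most `D`. -/
noncomputable def rateK (N : ℕ) (D γsys a b q r s τ ρ : ℝ) (B : Matrix n m ℝ) (Q : Matrix n n ℝ)
    (R : Matrix m m ℝ) (S : Matrix m n ℝ) : ℝ :=
  γsys * ρ * lambdaMin (R - S * Q⁻¹ * Sᵀ) / (ρ + Real.log (a * N)) *
    (1 / (max 1 (lambdaMax R +
          4 * τ ^ 2 * (‖B‖ ^ 2 * ‖Q‖ + ‖B‖ * ‖S‖) / (1 - Real.exp (-2 * ρ)) ^ 2) *
        Real.log (γsys * constM N b q r s τ ρ Q S * N * D + constM N b q r s τ ρ Q S * N + 1)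
      + lambdaMin (R - S * Q⁻¹ * Sᵀ)))

end Constants

/-!
The proof has two halves: optimality of `K` is first turned into algebra, and the algebra is then
read as a well conditioned, spatially localized linear system for the optimal controls.

*Optimality.* As `A` is stable, the zero gain has finite average cost, hence so does `K`. The
second moment of the state at time `t` dominates `∑_{k < t} Fᵏ (Fᵏ)ᵀ`, `F = A - BK`, so a bounded
average makes the powers of `F` square summable (`IsOptimalGain.tendsto_pow_zero`). Let `P'` be the
cost matrix of `K` and `K'` the gain that is greedy for `P'`. The average cost of `K'` is at most
the cost of `K` minus `trace ((K - K')ᵀ (R + BᵀP'B) (K - K'))`, so that `K = K'`; this is the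
Riccati equation (`IsOptimalGain.riccati`).

*The open loop equation.* Let `P = Q + AᵀPA` be the cost matrix of the uncontrolled system and
`L = BᵀPA + S`. As a function of the controls over a horizon `T`, the cost from the zero state, with
terminal cost `P`, is a quadratic form with a block Toeplitz matrix `M`, whose blocks are
`R + BᵀPB` on the diagonal and `L Aᵏ B` off it (`toeplitz_form_eq_cost`). The Schur complement
bounds it from below by `λ_min(R - SQ⁻¹Sᵀ)` and a Schur test bounds it from above by
`λ_max(R) + 4τ²(‖B‖²‖Q‖ + ‖B‖‖S‖)/(1 - e^{-2ρ})²` (`le_toeplitz_form`, `toeplitz_form_le`). With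
`Δ = P' - P`, the Riccati equation says that the controls `u_s = K Fˢ` satisfy `M u = g + e`, where
`g_t = L Aᵗ` and `e_t = Bᵀ (Aᵀ)^{T-1-t} Δ F^T` is exponentially small in `T`
(`sum_toeplitzBlock_mul_gain`).

*Spatial decay.* The blocks of `M` and `g` decay in space, at the reduced rate
`γsys ρ / (ρ + log (aN))`: the first terms of the Lyapunov series involve few factors `A` and are
therefore localized, and the remaining ones are small by stability (`IsSED.lyapunov_mul_pow`). As
`u_0 = K`, it remains to solve `M u = g` approximately by a truncated Neumann series. One further
term improves the error by the factor `1 - λ_min / β` (`norm_sub_neumannSum_le`) but worsens the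
localization constant by the factor `1 + c_M N T` (`norm_blockPart_neumannSum_le`). In `isSED_gain`
the number of terms and the horizon are chosen, for each pair of agents separately, so that the
localized part, the truncation error and the horizon error all decay like `e^{-γ_K dist(i,j)}`.
-/

set_option linter.unusedSectionVars false

/-! ### Exponential stability and Stein equations -/

section Stability

variable {n m : Type*} [Fintype n] [DecidableEq n] [Fintype m] [DecidableEq m]

lemma norm_transpose_eq (X : Matrix m n ℝ) : ‖Xᵀ‖ = ‖X‖ := by
  rw [← conjTranspose_eq_transpose_of_trivial, l2_opNorm_conjTranspose]

lemma IsExpStable.mono {X : Matrix n n ℝ} {τ τ' ρ ρ' : ℝ} (h : IsExpStable X τ ρ) (hτ0 : 0 ≤ τ)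
    (hτ : τ ≤ τ') (hρ : ρ' ≤ ρ) : IsExpStable X τ' ρ' := by
  intro k
  refine (h k).trans (mul_le_mul hτ (Real.exp_le_exp.2 ?_) (Real.exp_pos _).le (hτ0.trans hτ))
  have : (0 : ℝ) ≤ k := k.cast_nonneg
  nlinarith

lemma IsExpStable.transpose {X : Matrix n n ℝ} {τ ρ : ℝ} (h : IsExpStable X τ ρ) :
    IsExpStable Xᵀ τ ρ := by
  intro k
  rw [← transpose_pow, norm_transpose_eq]
  exact h k

/-- Once some power has norm at most `e⁻¹`, the bounded powers decay geometrically. -/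
lemma exists_isExpStable {X : Matrix n n ℝ} (h : Tendsto (fun k : ℕ => X ^ k) atTop (𝓝 0)) :
    ∃ τ ρ : ℝ, 1 ≤ τ ∧ 0 < ρ ∧ IsExpStable X τ ρ := by
  have hn : Tendsto (fun k : ℕ => ‖X ^ k‖) atTop (𝓝 0) := by simpa using h.norm
  obtain ⟨C, hC⟩ := hn.bddAbove_range
  obtain ⟨p, hp1, hp⟩ := ((hn.eventually (gt_mem_nhds (Real.exp_pos (-1)))).and
    (eventually_ge_atTop 1)).exists.imp fun _ => And.symm
  have hp0 : (0 : ℝ) < p := by exact_mod_cast hp1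
  have hC' : ∀ k, ‖X ^ k‖ ≤ max 1 C := fun k => (hC ⟨k, rfl⟩).trans (le_max_right _ _)
  have h1 : (1 : ℝ) ≤ max 1 C := le_max_left _ _
  have he : (1 : ℝ) ≤ Real.exp 1 := Real.one_le_exp zero_le_one
  refine ⟨max 1 C * Real.exp 1, 1 / p, by nlinarith, by positivity, fun k => ?_⟩
  rw [mul_assoc, ← Real.exp_add]
  induction k using Nat.strong_induction_on with
  | _ k ih =>
    rcases lt_or_ge k p with hk | hk
    · refine (hC' k).trans (le_mul_of_one_le_right (by positivity) (Real.one_le_exp ?_))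
      have : (k : ℝ) / p ≤ 1 := (div_le_one hp0).2 (by exact_mod_cast hk.le)
      have e : (1 : ℝ) + -(1 / p) * k = 1 - k / p := by ring
      rw [e]; linarith
    · have h2 := ih (k - p) (by omega)
      have e : X ^ k = X ^ p * X ^ (k - p) := by rw [← pow_add]; congr 1; omega
      rw [e]
      refine (norm_mul_le _ _).trans ((mul_le_mul hp.le h2 (norm_nonneg _)
        (Real.exp_pos _).le).trans (le_of_eq ?_))
      rw [mul_left_comm, ← Real.exp_add, Nat.cast_sub hk]
      congr 2
      field_simp
      ring

lemma IsExpStable.tendsto_zero {X : Matrix n n ℝ} {τ ρ : ℝ} (h : IsExpStable X τ ρ) (hρ : 0 < ρ) :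
    Tendsto (fun k : ℕ => X ^ k) atTop (𝓝 0) := by
  refine squeeze_zero_norm h ?_
  have h1 : Tendsto (fun k : ℕ => τ * Real.exp (-ρ) ^ k) atTop (𝓝 (τ * 0)) :=
    (tendsto_pow_atTop_nhds_zero_of_lt_one (Real.exp_pos _).le
      (Real.exp_lt_one_iff.2 (by linarith))).const_mul τ
  simpa [← Real.exp_nat_mul, mul_comm] using h1

/-- Finitely many unfoldings of the Stein equation `X = H + F X G`. -/
lemma stein_iterate {F G H X : Matrix n n ℝ} (hX : X = H + F * X * G) (J : ℕ) :
    X = ∑ j ∈ Finset.range J, F ^ j * H * G ^ j + F ^ J * X * G ^ J := by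
  induction J with
  | zero => simp
  | succ J ih =>
    rw [Finset.sum_range_succ, add_assoc]
    have : F ^ J * X * G ^ J = F ^ J * H * G ^ J + F ^ (J + 1) * X * G ^ (J + 1) := by
      conv_lhs => rw [hX]
      rw [pow_succ F, pow_succ' G]
      noncomm_ring
    rw [← this, ← ih]

/-- The Stein equation is solved by the series `∑ⱼ Fʲ H Gʲ`. -/
lemma exists_stein {F G : Matrix n n ℝ} {τ ρ : ℝ} (hρ : 0 < ρ) (hF : IsExpStable F τ ρ)
    (hG : IsExpStable G τ ρ) (H : Matrix n n ℝ) : ∃ X, X = H + F * X * G := by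
  have : CompleteSpace (Matrix n n ℝ) := FiniteDimensional.complete ℝ _
  have hτ : 0 ≤ τ := by simpa using (norm_nonneg _).trans (hF 0)
  have hs : Summable fun j : ℕ => F ^ j * H * G ^ j := by
    refine Summable.of_norm_bounded (g := fun j : ℕ => τ ^ 2 * ‖H‖ * Real.exp (-2 * ρ) ^ j)
      ((summable_geometric_of_lt_one (Real.exp_pos _).le
        (Real.exp_lt_one_iff.2 (by linarith))).mul_left _) fun j => ?_
    calc ‖F ^ j * H * G ^ j‖ ≤ ‖F ^ j‖ * ‖H‖ * ‖G ^ j‖ :=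
          (norm_mul_le _ _).trans (by gcongr; exact norm_mul_le _ _)
      _ ≤ (τ * Real.exp (-ρ * j)) * ‖H‖ * (τ * Real.exp (-ρ * j)) := by
          gcongr
          · exact hF j
          · exact hG j
      _ = _ := by
          rw [← Real.exp_nat_mul, show (j : ℝ) * (-2 * ρ) = -ρ * j + -ρ * j by ring, Real.exp_add]
          ring
  refine ⟨∑' j : ℕ, F ^ j * H * G ^ j, ?_⟩
  conv_lhs => rw [hs.tsum_eq_zero_add]
  rw [← hs.tsum_mul_left, ← (hs.mul_left F).tsum_mul_right]
  simp only [pow_zero, one_mul, mul_one]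
  congr 2
  ext1 j
  rw [pow_succ' F, pow_succ G]
  noncomm_ring

/-- A geometric bound on the terms of the series `∑ⱼ Fʲ H Gʲ` bounds every solution of the Stein
equation; in particular the solution is unique. -/
lemma norm_stein_le {F G H X : Matrix n n ℝ} {τ ρ C θ : ℝ} (hρ : 0 < ρ)
    (hF : IsExpStable F τ ρ) (hG : IsExpStable G τ ρ) (hX : X = H + F * X * G)
    (hC : 0 ≤ C) (hθ0 : 0 ≤ θ) (hθ : θ < 1) (hH : ∀ j, ‖F ^ j * H * G ^ j‖ ≤ C * θ ^ j) :
    ‖X‖ ≤ C / (1 - θ) := by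
  have ht : Tendsto (fun J : ℕ => C / (1 - θ) + ‖F ^ J * X * G ^ J‖) atTop
      (𝓝 (C / (1 - θ) + ‖(0 : Matrix n n ℝ) * X * 0‖)) :=
    (((hF.tendsto_zero hρ).mul_const X).mul (hG.tendsto_zero hρ)).norm.const_add _
  rw [mul_zero, norm_zero, add_zero] at ht
  refine ge_of_tendsto' ht fun J => ?_
  conv_lhs => rw [stein_iterate hX J]
  refine (norm_add_le _ _).trans (add_le_add ?_ le_rfl)
  refine (norm_sum_le_of_le _ fun j _ => hH j).trans ?_
  rw [← Finset.mul_sum, div_eq_mul_inv, ← tsum_geometric_of_lt_one hθ0 hθ]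
  exact mul_le_mul_of_nonneg_left ((summable_geometric_of_lt_one hθ0 hθ).sum_le_tsum _
    fun j _ => pow_nonneg hθ0 j) hC

end Stability

/-! ### Extreme eigenvalues and Schur complements -/

section Spectral

variable {n m : Type*} [Fintype n] [DecidableEq n] [Fintype m] [DecidableEq m]

lemma finite_spectrum_of_isHermitian {X : Matrix n n ℝ} (hX : X.IsHermitian) :
    (spectrum ℝ X).Finite := by
  rw [hX.spectrum_real_eq_range_eigenvalues]
  exact Set.finite_range _

lemma lambdaMin_mul_dotProduct_le {X : Matrix n n ℝ} (hX : X.IsHermitian) (v : n → ℝ) :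
    lambdaMin X * (v ⬝ᵥ v) ≤ v ⬝ᵥ X *ᵥ v := by
  have h : (X - algebraMap ℝ _ (lambdaMin X)).PosSemidef := by
    rw [posSemidef_iff_isHermitian_and_spectrum_nonneg]
    refine ⟨hX.sub ?_, ?_⟩
    · rw [algebraMap_eq_diagonal]
      exact isHermitian_diagonal _
    · rw [← spectrum.sub_singleton_eq]
      rintro _ ⟨x, hx, _, rfl, rfl⟩
      exact sub_nonneg.2 (csInf_le (finite_spectrum_of_isHermitian hX).bddBelow hx)
  have := h.dotProduct_mulVec_nonneg v
  simpa [sub_mulVec, dotProduct_sub, Algebra.algebraMap_eq_smul_one, smul_mulVec] using this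

lemma dotProduct_le_lambdaMax_mul {X : Matrix n n ℝ} (hX : X.IsHermitian) (v : n → ℝ) :
    v ⬝ᵥ X *ᵥ v ≤ lambdaMax X * (v ⬝ᵥ v) := by
  have h : (algebraMap ℝ _ (lambdaMax X) - X).PosSemidef := by
    rw [posSemidef_iff_isHermitian_and_spectrum_nonneg]
    refine ⟨IsHermitian.sub ?_ hX, ?_⟩
    · rw [algebraMap_eq_diagonal]
      exact isHermitian_diagonal _
    · rw [← spectrum.singleton_sub_eq]
      rintro _ ⟨_, rfl, x, hx, rfl⟩
      exact sub_nonneg.2 (le_csSup (finite_spectrum_of_isHermitian hX).bddAbove hx)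
  have := h.dotProduct_mulVec_nonneg v
  simpa [sub_mulVec, dotProduct_sub, Algebra.algebraMap_eq_smul_one, smul_mulVec] using this

/-- This includes the empty index type, where the spectrum is empty and `sInf ∅ = 0`. -/
lemma lambdaMin_nonneg_of_posDef {X : Matrix n n ℝ} (hX : X.PosDef) : 0 ≤ lambdaMin X := by
  refine Real.sInf_nonneg fun x hx => ?_
  exact (posSemidef_iff_isHermitian_and_spectrum_nonneg.1 hX.posSemidef).2 hx

lemma lambdaMin_pos_of_posDef [Nonempty n] {X : Matrix n n ℝ} (hX : X.PosDef) :
    0 < lambdaMin X := by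
  have hne : (spectrum ℝ X).Nonempty := by
    rw [hX.isHermitian.spectrum_real_eq_range_eigenvalues]
    exact Set.range_nonempty _
  have := hne.csInf_mem (finite_spectrum_of_isHermitian hX.isHermitian)
  unfold lambdaMin
  rw [hX.isHermitian.spectrum_real_eq_range_eigenvalues] at this ⊢
  obtain ⟨i, hi⟩ := this
  rw [← hi]
  exact hX.eigenvalues_pos i

/-- Completing the square in `x`. -/
lemma stageCost_eq_schur {Q : Matrix n n ℝ} (R : Matrix m m ℝ) (S : Matrix m n ℝ) (hQ : Q.PosDef)
    (x : n → ℝ) (u : m → ℝ) :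
    stageCost Q R S x u = (x + Q⁻¹ *ᵥ (Sᵀ *ᵥ u)) ⬝ᵥ Q *ᵥ (x + Q⁻¹ *ᵥ (Sᵀ *ᵥ u)) +
      u ⬝ᵥ (R - S * Q⁻¹ * Sᵀ) *ᵥ u := by
  have hu : IsUnit Q.det := (isUnit_iff_isUnit_det _).1 hQ.isUnit
  have h1 : Q *ᵥ (Q⁻¹ *ᵥ (Sᵀ *ᵥ u)) = Sᵀ *ᵥ u := by
    rw [mulVec_mulVec, mul_nonsing_inv _ hu, one_mulVec]
  have hQt : Qᵀ = Q := hQ.isHermitian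
  have h2 : ∀ y : n → ℝ, (Q⁻¹ *ᵥ (Sᵀ *ᵥ u)) ⬝ᵥ Q *ᵥ y = u ⬝ᵥ S *ᵥ y := by
    intro y
    rw [dotProduct_mulVec, ← mulVec_transpose, hQt, h1, mulVec_transpose, ← dotProduct_mulVec]
  rw [stageCost, mulVec_add, h1, add_dotProduct, dotProduct_add, dotProduct_add, h2]
  have h3 : x ⬝ᵥ Sᵀ *ᵥ u = u ⬝ᵥ S *ᵥ x := by
    rw [mulVec_transpose, dotProduct_comm, ← dotProduct_mulVec]
  have h4 : (Q⁻¹ *ᵥ (Sᵀ *ᵥ u)) ⬝ᵥ Sᵀ *ᵥ u = u ⬝ᵥ (S * Q⁻¹ * Sᵀ) *ᵥ u := by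
    rw [mulVec_transpose, dotProduct_comm, ← dotProduct_mulVec, ← mulVec_transpose, mulVec_mulVec,
      mulVec_mulVec, Matrix.mul_assoc]
  rw [h3, h4, sub_mulVec, dotProduct_sub]
  ring

/-- The state can lower the cost of a control `u` at most to its Schur complement value. -/
lemma lambdaMin_schur_le_stageCost {Q : Matrix n n ℝ} {R : Matrix m m ℝ} {S : Matrix m n ℝ}
    (hQ : Q.PosDef) (hRS : (R - S * Q⁻¹ * Sᵀ).PosDef) (x : n → ℝ) (u : m → ℝ) :
    lambdaMin (R - S * Q⁻¹ * Sᵀ) * (u ⬝ᵥ u) ≤ stageCost Q R S x u := by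
  rw [stageCost_eq_schur R S hQ]
  have h1 := hQ.posSemidef.dotProduct_mulVec_nonneg (x + Q⁻¹ *ᵥ (Sᵀ *ᵥ u))
  rw [star_trivial] at h1
  have h2 := lambdaMin_mul_dotProduct_le hRS.isHermitian u
  linarith

lemma stageCost_nonneg {Q : Matrix n n ℝ} {R : Matrix m m ℝ} {S : Matrix m n ℝ}
    (hQ : Q.PosDef) (hRS : (R - S * Q⁻¹ * Sᵀ).PosDef) (x : n → ℝ) (u : m → ℝ) :
    0 ≤ stageCost Q R S x u :=
  (mul_nonneg (lambdaMin_nonneg_of_posDef hRS) (by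
    simpa using dotProduct_star_self_nonneg u)).trans (lambdaMin_schur_le_stageCost hQ hRS x u)

lemma stageCost_pos {Q : Matrix n n ℝ} {R : Matrix m m ℝ} {S : Matrix m n ℝ}
    (hQ : Q.PosDef) (hRS : (R - S * Q⁻¹ * Sᵀ).PosDef) {x : n → ℝ} (hx : x ≠ 0) (u : m → ℝ) :
    0 < stageCost Q R S x u := by
  rw [stageCost_eq_schur R S hQ]
  by_cases hu : u = 0
  · simpa [hu] using hQ.dotProduct_mulVec_pos hx
  · have h1 := hQ.posSemidef.dotProduct_mulVec_nonneg (x + Q⁻¹ *ᵥ (Sᵀ *ᵥ u))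
    have h2 := hRS.dotProduct_mulVec_pos hu
    rw [star_trivial] at h1 h2
    linarith

lemma transpose_eq_of_posDef_schur {Q : Matrix n n ℝ} {R : Matrix m m ℝ} {S : Matrix m n ℝ}
    (hQ : Q.PosDef) (hRS : (R - S * Q⁻¹ * Sᵀ).PosDef) : Rᵀ = R := by
  have h1 : (R - S * Q⁻¹ * Sᵀ)ᵀ = R - S * Q⁻¹ * Sᵀ := hRS.isHermitian
  have h2 : Qᵀ = Q := hQ.isHermitian
  have h3 : (S * Q⁻¹ * Sᵀ)ᵀ = S * Q⁻¹ * Sᵀ := by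
    rw [transpose_mul, transpose_mul, transpose_transpose, transpose_nonsing_inv, h2,
      Matrix.mul_assoc]
  rw [transpose_sub, h3] at h1
  exact sub_left_injective h1

end Spectral

/-! ### Second moments of a linear recursion driven by white noise -/

section Moments

variable {n m Ω : Type*} [Fintype n] [DecidableEq n] [Fintype m] [DecidableEq m]
  [MeasurableSpace Ω] {μ : Measure Ω} {w : ℕ → Ω → (n → ℝ)}

lemma IsStandardGaussianNoise.measurePreserving_coord (hw : IsStandardGaussianNoise μ w) (t : ℕ)
    (i : n) : MeasurePreserving (fun ω => w t ω i) μ (gaussianReal 0 1) :=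
  (measurePreserving_eval (fun _ : n => gaussianReal 0 1) i).comp ⟨hw.measurable t, hw.law t⟩

lemma IsStandardGaussianNoise.memLp (hw : IsStandardGaussianNoise μ w) (t : ℕ) (i : n) :
    MemLp (fun ω => w t ω i) 2 μ :=
  (memLp_id_gaussianReal' 2 ENNReal.ofNat_ne_top).comp_measurePreserving
    (hw.measurePreserving_coord t i)

lemma integrable_mul_of_memLp_two {f g : Ω → ℝ} (hf : MemLp f 2 μ) (hg : MemLp g 2 μ) :
    Integrable (fun ω => f ω * g ω) μ :=
  hf.integrable_mul hg

lemma IsStandardGaussianNoise.integral_coord (hw : IsStandardGaussianNoise μ w) (t : ℕ) (i : n) :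
    ∫ ω, w t ω i ∂μ = 0 := by
  have h := (hw.measurePreserving_coord t i)
  rw [← integral_id_gaussianReal (μ := 0) (v := 1), ← h.map_eq,
    integral_map h.measurable.aemeasurable (by fun_prop)]

lemma IsStandardGaussianNoise.integral_mul_same (hw : IsStandardGaussianNoise μ w) (t : ℕ)
    (i j : n) : ∫ ω, w t ω i * w t ω j ∂μ = (1 : Matrix n n ℝ) i j := by
  rw [one_apply]
  split_ifs with hij
  · subst hij
    have h := hw.measurePreserving_coord t i
    have hv := variance_fun_id_gaussianReal (μ := 0) (v := 1)
    rw [variance_of_integral_eq_zero (by fun_prop) (by simp), ← h.map_eq,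
      integral_map h.measurable.aemeasurable (by fun_prop)] at hv
    simpa [sq] using hv
  · have h1 : ∫ x : n → ℝ, x i * x j ∂(μ.map (w t)) = 0 := by
      rw [hw.law t]
      have hi := (iIndepFun_pi (μ := fun _ : n => gaussianReal 0 1)
        (X := fun (_ : n) (x : ℝ) => x) (by fun_prop)).indepFun hij
      rw [hi.integral_fun_mul_eq_mul_integral (measurable_pi_apply i).aestronglyMeasurable
        (measurable_pi_apply j).aestronglyMeasurable]
      have : ∫ x : n → ℝ, x i ∂(Measure.pi fun _ : n => gaussianReal 0 1) = 0 := by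
        rw [← hw.law t, integral_map (hw.measurable t).aemeasurable
          (measurable_pi_apply i).aestronglyMeasurable]
        exact hw.integral_coord t i
      simp only [this, zero_mul]
    rwa [integral_map (hw.measurable t).aemeasurable (by fun_prop)] at h1

lemma IsStandardGaussianNoise.integral_mul_of_ne (hw : IsStandardGaussianNoise μ w) {s t : ℕ}
    (hst : s ≠ t) (i j : n) : ∫ ω, w s ω i * w t ω j ∂μ = 0 := by
  have h : IndepFun (fun ω => w s ω i) (fun ω => w t ω j) μ :=
    (hw.indep.indepFun hst).comp (φ := fun x : n → ℝ => x i) (ψ := fun x : n → ℝ => x j)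
      (measurable_pi_apply i) (measurable_pi_apply j)
  rw [h.integral_fun_mul_eq_mul_integral (hw.memLp s i).1 (hw.memLp t j).1, hw.integral_coord,
    zero_mul]

/-- Second moment matrices `𝔼 x_t x_tᵀ` of `x_{t+1} = F x_t + w_t`. -/
def secondMoment (F : Matrix n n ℝ) (x₀ : n → ℝ) : ℕ → Matrix n n ℝ
  | 0 => vecMulVec x₀ x₀
  | t + 1 => F * secondMoment F x₀ t * Fᵀ + 1

lemma trace_mul_secondMoment_zero (Z F : Matrix n n ℝ) (x₀ : n → ℝ) :
    (Z * secondMoment F x₀ 0).trace = x₀ ⬝ᵥ Z *ᵥ x₀ := by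
  rw [secondMoment, mul_vecMulVec, trace_vecMulVec, dotProduct_comm]

lemma trace_mul_secondMoment_succ (Z F : Matrix n n ℝ) (x₀ : n → ℝ) (t : ℕ) :
    (Z * secondMoment F x₀ (t + 1)).trace =
      (Fᵀ * Z * F * secondMoment F x₀ t).trace + Z.trace := by
  rw [secondMoment, Matrix.mul_add, trace_add, Matrix.mul_one, ← Matrix.mul_assoc,
    trace_mul_comm, ← Matrix.mul_assoc, ← Matrix.mul_assoc]

lemma trace_mul_secondMoment_nonneg {Z : Matrix n n ℝ} (hZ : Z.PosSemidef) (F : Matrix n n ℝ)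
    (x₀ : n → ℝ) (t : ℕ) : 0 ≤ (Z * secondMoment F x₀ t).trace := by
  induction t generalizing Z with
  | zero =>
    rw [trace_mul_secondMoment_zero]
    simpa using hZ.dotProduct_mulVec_nonneg x₀
  | succ t ih =>
    rw [trace_mul_secondMoment_succ]
    refine add_nonneg (ih ?_) hZ.trace_nonneg
    rw [← conjTranspose_eq_transpose_of_trivial]
    exact hZ.conjTranspose_mul_mul_same F

/-- Square integrability, lack of correlation with the present and future noise, and the second
moments are propagated together by induction. -/
lemma moments_linear_recursion [IsProbabilityMeasure μ] (hw : IsStandardGaussianNoise μ w)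
    {F : Matrix n n ℝ} {x₀ : n → ℝ} {x : ℕ → Ω → (n → ℝ)} (h0 : ∀ ω, x 0 ω = x₀)
    (hx : ∀ t ω, x (t + 1) ω = F *ᵥ x t ω + w t ω) (t : ℕ) :
    (∀ i, MemLp (fun ω => x t ω i) 2 μ) ∧
    (∀ s, t ≤ s → ∀ i j, ∫ ω, x t ω i * w s ω j ∂μ = 0) ∧
    ∀ i j, ∫ ω, x t ω i * x t ω j ∂μ = secondMoment F x₀ t i j := by
  induction t with
  | zero =>
    simp only [h0]
    refine ⟨fun i => memLp_const _, fun s _ i j => ?_, fun i j => ?_⟩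
    · rw [integral_const_mul, hw.integral_coord, mul_zero]
    · simp [secondMoment, vecMulVec_apply]
  | succ t ih =>
    obtain ⟨h1, h2, h3⟩ := ih
    have e : ∀ ω i, x (t + 1) ω i = ∑ k, F i k * x t ω k + w t ω i := fun ω i => by
      rw [hx]; rfl
    have hwt := hw.memLp t
    have hF : ∀ i, MemLp (fun ω => ∑ k, F i k * x t ω k) 2 μ := fun i =>
      memLp_finsetSum _ fun k _ => (h1 k).const_mul _
    have hFw : ∀ s, t ≤ s → ∀ i j, ∫ ω, (∑ k, F i k * x t ω k) * w s ω j ∂μ = 0 := by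
      intro s hs i j
      simp only [Finset.sum_mul, mul_assoc]
      rw [integral_finsetSum _ fun k _ =>
        (integrable_mul_of_memLp_two (h1 k) (hw.memLp s j)).const_mul _]
      simp [integral_const_mul, h2 s hs]
    simp only [e]
    refine ⟨fun i => (hF i).add (hwt i), fun s hs i j => ?_, fun i j => ?_⟩
    · simp only [add_mul]
      rw [integral_add (integrable_mul_of_memLp_two (hF i) (hw.memLp s j))
        (integrable_mul_of_memLp_two (hwt i) (hw.memLp s j)), hFw s (by omega),
        hw.integral_mul_of_ne (by omega), add_zero]
    · have hFF : ∫ ω, (∑ k, F i k * x t ω k) * (∑ l, F j l * x t ω l) ∂μ =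
          (F * secondMoment F x₀ t * Fᵀ) i j := by
        simp only [Finset.sum_mul_sum, mul_mul_mul_comm]
        have hI : ∀ k l, Integrable (fun ω => F i k * F j l * (x t ω k * x t ω l)) μ :=
          fun k l => (integrable_mul_of_memLp_two (h1 k) (h1 l)).const_mul _
        rw [integral_finsetSum _ fun k _ => integrable_finsetSum _ fun l _ => hI k l]
        simp_rw [integral_finsetSum _ fun l _ => hI _ l, integral_const_mul, h3, mul_apply,
          transpose_apply, Finset.sum_mul]
        rw [Finset.sum_comm]
        refine Finset.sum_congr rfl fun _ _ => Finset.sum_congr rfl fun _ _ => by ring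
      have hwF : ∫ ω, w t ω i * (∑ k, F j k * x t ω k) ∂μ = 0 := by
        simp_rw [mul_comm (w t _ i)]
        exact hFw t le_rfl j i
      have I1 := integrable_mul_of_memLp_two (hF i) (hF j)
      have I2 := integrable_mul_of_memLp_two (hwt i) (hF j)
      have I3 := integrable_mul_of_memLp_two (hF i) (hwt j)
      have I4 := integrable_mul_of_memLp_two (hwt i) (hwt j)
      have I12 : Integrable (fun ω => (∑ k, F i k * x t ω k) * (∑ k, F j k * x t ω k) +
        w t ω i * ∑ k, F j k * x t ω k) μ := I1.add I2
      have I34 : Integrable (fun ω => (∑ k, F i k * x t ω k) * w t ω j + w t ω i * w t ω j) μ :=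
        I3.add I4
      simp only [add_mul, mul_add]
      rw [integral_add I12 I34, integral_add I1 I2, integral_add I3 I4, hFF, hwF, hFw t le_rfl,
        hw.integral_mul_same]
      simp [secondMoment]

/-- Gain form of the stage cost: `stageCost x (-K x) = xᵀ (gainCost K) x`. -/
def gainCost (Q : Matrix n n ℝ) (R : Matrix m m ℝ) (S : Matrix m n ℝ) (K : Matrix m n ℝ) :
    Matrix n n ℝ :=
  Q + Kᵀ * R * K - Kᵀ * S - Sᵀ * K

lemma stageCost_feedback (Q : Matrix n n ℝ) (R : Matrix m m ℝ) (S : Matrix m n ℝ)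
    (K : Matrix m n ℝ) (x : n → ℝ) :
    stageCost Q R S x (-(K *ᵥ x)) = x ⬝ᵥ gainCost Q R S K *ᵥ x := by
  have h1 : ∀ y : m → ℝ, x ⬝ᵥ Kᵀ *ᵥ y = (K *ᵥ x) ⬝ᵥ y := fun y => by
    rw [dotProduct_mulVec, vecMul_transpose]
  have h2 : x ⬝ᵥ Sᵀ *ᵥ (K *ᵥ x) = (K *ᵥ x) ⬝ᵥ S *ᵥ x := by
    rw [dotProduct_mulVec, vecMul_transpose, dotProduct_comm]
  simp only [stageCost, gainCost, sub_mulVec, add_mulVec, ← mulVec_mulVec, dotProduct_sub,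
    dotProduct_add, h1, h2, mulVec_neg, neg_dotProduct, dotProduct_neg]
  ring

lemma lintegral_stageCost_feedback [IsProbabilityMeasure μ] (hw : IsStandardGaussianNoise μ w)
    {Q : Matrix n n ℝ} {R : Matrix m m ℝ} {S : Matrix m n ℝ} (hQ : Q.PosDef)
    (hRS : (R - S * Q⁻¹ * Sᵀ).PosDef) (A : Matrix n n ℝ) (B : Matrix n m ℝ) (K : Matrix m n ℝ)
    (x₀ : n → ℝ) (t : ℕ) :
    ∫⁻ ω, ENNReal.ofReal (stageCost Q R S (feedbackState A B K x₀ w t ω)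
      (-(K *ᵥ feedbackState A B K x₀ w t ω))) ∂μ =
      ENNReal.ofReal (gainCost Q R S K * secondMoment (A - B * K) x₀ t).trace := by
  have hx : ∀ t ω, feedbackState A B K x₀ w (t + 1) ω =
      (A - B * K) *ᵥ feedbackState A B K x₀ w t ω + w t ω := fun t ω => by
    rw [feedbackState, mulVec_neg, mulVec_mulVec, ← sub_eq_add_neg, ← sub_mulVec]
  obtain ⟨h1, -, h3⟩ := moments_linear_recursion hw (F := A - B * K) (x₀ := x₀)
    (x := feedbackState A B K x₀ w) (fun _ => rfl) hx t
  have hI : ∀ i j, Integrable (fun ω => gainCost Q R S K i j *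
      (feedbackState A B K x₀ w t ω j * feedbackState A B K x₀ w t ω i)) μ :=
    fun i j => (integrable_mul_of_memLp_two (h1 j) (h1 i)).const_mul _
  have e : ∀ ω, stageCost Q R S (feedbackState A B K x₀ w t ω)
      (-(K *ᵥ feedbackState A B K x₀ w t ω)) = ∑ i, ∑ j, gainCost Q R S K i j *
      (feedbackState A B K x₀ w t ω j * feedbackState A B K x₀ w t ω i) := fun ω => by
    rw [stageCost_feedback]
    simp only [dotProduct, mulVec, Finset.mul_sum]
    exact Finset.sum_congr rfl fun _ _ => Finset.sum_congr rfl fun _ _ => by ring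
  have hI2 := integrable_finsetSum Finset.univ fun i _ =>
    integrable_finsetSum Finset.univ fun j _ => hI i j
  rw [← ofReal_integral_eq_lintegral_ofReal (by simpa only [e] using hI2)
    (Eventually.of_forall fun ω => stageCost_nonneg hQ hRS _ _)]
  congr 1
  simp only [e]
  rw [integral_finsetSum _ fun i _ => integrable_finsetSum _ fun j _ => hI i j]
  simp_rw [integral_finsetSum _ fun j _ => hI _ j, integral_const_mul, h3]
  simp [trace, mul_apply]

lemma gainCost_transpose {Q : Matrix n n ℝ} {R : Matrix m m ℝ} (hQ : Qᵀ = Q) (hR : Rᵀ = R)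
    (S K : Matrix m n ℝ) : (gainCost Q R S K)ᵀ = gainCost Q R S K := by
  simp only [gainCost, transpose_sub, transpose_add, transpose_mul, transpose_transpose, hQ, hR,
    Matrix.mul_assoc]
  abel

lemma gainCost_posDef {Q : Matrix n n ℝ} {R : Matrix m m ℝ} {S : Matrix m n ℝ}
    (hQ : Q.PosDef) (hRS : (R - S * Q⁻¹ * Sᵀ).PosDef) (K : Matrix m n ℝ) :
    (gainCost Q R S K).PosDef := by
  refine PosDef.of_dotProduct_mulVec_pos
    (gainCost_transpose hQ.isHermitian (transpose_eq_of_posDef_schur hQ hRS) S K) fun x hx => ?_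
  rw [star_trivial, ← stageCost_feedback]
  exact stageCost_pos hQ hRS hx _

lemma averageCost_feedback [IsProbabilityMeasure μ] (hw : IsStandardGaussianNoise μ w)
    {Q : Matrix n n ℝ} {R : Matrix m m ℝ} {S : Matrix m n ℝ} (hQ : Q.PosDef)
    (hRS : (R - S * Q⁻¹ * Sᵀ).PosDef) (A : Matrix n n ℝ) (B : Matrix n m ℝ) (K : Matrix m n ℝ)
    (x₀ : n → ℝ) :
    averageCost μ Q R S (feedbackState A B K x₀ w)
      (fun t ω => -(K *ᵥ feedbackState A B K x₀ w t ω)) =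
    limsup (fun T : ℕ => ENNReal.ofReal ((T : ℝ)⁻¹ * ∑ t ∈ Finset.range T,
      (gainCost Q R S K * secondMoment (A - B * K) x₀ t).trace)) atTop := by
  unfold averageCost
  refine limsup_congr ((eventually_gt_atTop 0).mono fun T hT => ?_)
  have hpos : ∀ t, 0 ≤ (gainCost Q R S K * secondMoment (A - B * K) x₀ t).trace :=
    trace_mul_secondMoment_nonneg (gainCost_posDef hQ hRS K).posSemidef _ _
  simp only [lintegral_stageCost_feedback hw hQ hRS]
  rw [← ENNReal.ofReal_sum_of_nonneg fun t _ => hpos t, ENNReal.ofReal_mul (by positivity),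
    ENNReal.ofReal_inv_of_pos (by exact_mod_cast hT), ENNReal.ofReal_natCast]

/-- A feedback law, recorded as a sequence of controls, reproduces its own closed loop state. -/
lemma feedbackState_eq_lqrState (A : Matrix n n ℝ) (B : Matrix n m ℝ) (K : Matrix m n ℝ)
    (x₀ : n → ℝ) (w : ℕ → Ω → (n → ℝ)) :
    lqrState A B x₀ w (fun t ω => -(K *ᵥ feedbackState A B K x₀ w t ω)) =
      feedbackState A B K x₀ w := by
  funext t ω
  induction t with
  | zero => rfl
  | succ t ih => rw [lqrState, ih, feedbackState]

lemma isCausalControl_feedback (A : Matrix n n ℝ) (B : Matrix n m ℝ) (K : Matrix m n ℝ)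
    (x₀ : n → ℝ) (w : ℕ → Ω → (n → ℝ)) :
    IsCausalControl w (fun t ω => -(K *ᵥ feedbackState A B K x₀ w t ω)) := by
  have h : ∀ t, Measurable[⨆ s : Fin t, MeasurableSpace.comap (w s) inferInstance]
      (feedbackState A B K x₀ w t) := by
    intro t
    induction t with
    | zero => exact measurable_const
    | succ t ih =>
      have hle : (⨆ s : Fin t, MeasurableSpace.comap (w s) inferInstance) ≤
          ⨆ s : Fin (t + 1), MeasurableSpace.comap (w s) inferInstance :=
        iSup_le fun s => le_iSup_of_le s.castSucc le_rfl
      have h1 := ih.mono hle le_rfl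
      have h2 : Measurable[⨆ s : Fin (t + 1), MeasurableSpace.comap (w s) inferInstance] (w t) :=
        (comap_measurable (w t)).mono (le_iSup_of_le (Fin.last t) le_rfl) le_rfl
      have h3 : Measurable fun p : (n → ℝ) × (n → ℝ) => A *ᵥ p.1 + B *ᵥ (-(K *ᵥ p.1)) + p.2 := by
        fun_prop
      exact h3.comp (h1.prodMk h2)
  intro t
  have h3 : Measurable fun x : n → ℝ => -(K *ᵥ x) := by fun_prop
  exact h3.comp (h t)

end Moments

/-! ### Optimal gains are stabilizing and solve the Riccati equation -/

section Optimality

variable {n m Ω : Type*} [Fintype n] [DecidableEq n] [Fintype m] [DecidableEq m]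

/-- Telescoped Bellman identity: the expected cost of `Z` over the horizon `T` along
`x_{t+1} = F x_t + w_t`, in terms of a solution `P` of a Bellman equation with defect `V`. Stability
of `F` is not needed. -/
lemma sum_trace_mul_secondMoment {F P Z V : Matrix n n ℝ} (h : P = Z + V + Fᵀ * P * F)
    (x₀ : n → ℝ) (T : ℕ) :
    ∑ t ∈ Finset.range T, (Z * secondMoment F x₀ t).trace =
      (P * secondMoment F x₀ 0).trace - (P * secondMoment F x₀ T).trace + T * P.trace -
        ∑ t ∈ Finset.range T, (V * secondMoment F x₀ t).trace := by
  induction T with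
  | zero => simp
  | succ T ih =>
    have h1 : (P * secondMoment F x₀ T).trace = (Z * secondMoment F x₀ T).trace +
        (V * secondMoment F x₀ T).trace + (Fᵀ * P * F * secondMoment F x₀ T).trace := by
      conv_lhs => rw [h]
      simp only [Matrix.add_mul, trace_add]
    rw [Finset.sum_range_succ, Finset.sum_range_succ, ih, trace_mul_secondMoment_succ]
    push_cast
    linarith

lemma tendsto_secondMoment {F : Matrix n n ℝ} {τ ρ : ℝ} (hρ : 0 < ρ) (hF : IsExpStable F τ ρ)
    (x₀ : n → ℝ) : ∃ Y, Tendsto (secondMoment F x₀) atTop (𝓝 Y) := by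
  obtain ⟨Y, hY⟩ := exists_stein hρ hF hF.transpose 1
  have h : ∀ t, secondMoment F x₀ t = Y + F ^ t * (secondMoment F x₀ 0 - Y) * Fᵀ ^ t := by
    intro t
    induction t with
    | zero => simp
    | succ t ih =>
      change F * secondMoment F x₀ t * Fᵀ + 1 = _
      rw [ih]
      generalize secondMoment F x₀ 0 - Y = C
      conv_rhs => rw [hY]
      rw [pow_succ' F, pow_succ Fᵀ]
      noncomm_ring
  refine ⟨Y, ?_⟩
  have ht : Tendsto (fun t : ℕ => Y + F ^ t * (secondMoment F x₀ 0 - Y) * Fᵀ ^ t) atTop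
      (𝓝 (Y + 0 * (secondMoment F x₀ 0 - Y) * 0)) :=
    (((hF.tendsto_zero hρ).mul_const _).mul (hF.transpose.tendsto_zero hρ)).const_add Y
  simp only [zero_mul, add_zero] at ht
  exact ht.congr fun t => (h t).symm

/-- The average cost of a stable recursion is the trace of the cost matrix, independently of the
initial state. -/
lemma tendsto_average_trace {F P Z : Matrix n n ℝ} {τ ρ : ℝ} (hρ : 0 < ρ)
    (hF : IsExpStable F τ ρ) (hP : P = Z + Fᵀ * P * F) (x₀ : n → ℝ) :
    Tendsto (fun T : ℕ => (T : ℝ)⁻¹ * ∑ t ∈ Finset.range T, (Z * secondMoment F x₀ t).trace)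
      atTop (𝓝 P.trace) := by
  obtain ⟨Y, hY⟩ := tendsto_secondMoment hρ hF x₀
  have hP' : P = Z + 0 + Fᵀ * P * F := by rw [add_zero, ← hP]
  have h1 : Tendsto (fun T : ℕ => (P * secondMoment F x₀ T).trace) atTop (𝓝 (P * Y).trace) :=
    ((continuous_id.matrix_trace).tendsto _).comp (hY.const_mul P)
  have h2 : Tendsto (fun T : ℕ => (T : ℝ)⁻¹ *
      ((P * secondMoment F x₀ 0).trace - (P * secondMoment F x₀ T).trace) + P.trace) atTop
      (𝓝 (0 * ((P * secondMoment F x₀ 0).trace - (P * Y).trace) + P.trace)) :=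
    (tendsto_inv_atTop_nhds_zero_nat.mul (h1.const_sub _)).add_const _
  rw [zero_mul, zero_add] at h2
  refine h2.congr' ((eventually_gt_atTop 0).mono fun T hT => ?_)
  have hT' : (T : ℝ) ≠ 0 := by exact_mod_cast hT.ne'
  simp only [sum_trace_mul_secondMoment hP', Matrix.zero_mul, trace_zero, Finset.sum_const_zero,
    sub_zero]
  field_simp

/-- When `c ≤ Z`, the expected cost at time `t` dominates `c ∑_{k < t} ‖Fᵏ‖²` in the Frobenius norm,
the contribution of the noise accumulated up to that time. -/
lemma sum_frobenius_le_trace_mul_secondMoment {c : ℝ} {Z : Matrix n n ℝ} (hc : 0 ≤ c)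
    (hZ : (Z - c • (1 : Matrix n n ℝ)).PosSemidef) (F : Matrix n n ℝ) (x₀ : n → ℝ) (t : ℕ) :
    c * ∑ k ∈ Finset.range t, ((F ^ k)ᵀ * F ^ k).trace ≤ (Z * secondMoment F x₀ t).trace := by
  have h1 : c * ∑ k ∈ Finset.range t, ((F ^ k)ᵀ * F ^ k).trace ≤
      ((c • (1 : Matrix n n ℝ)) * secondMoment F x₀ t).trace := by
    rw [smul_mul, Matrix.one_mul, trace_smul, smul_eq_mul]
    refine mul_le_mul_of_nonneg_left ?_ hc
    have h2 : ∀ s, (((F ^ s)ᵀ * F ^ s) * secondMoment F x₀ t).trace ≥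
        ∑ k ∈ Finset.range t, ((F ^ (s + k))ᵀ * F ^ (s + k)).trace := by
      induction t with
      | zero =>
        intro s
        simp only [Finset.range_zero, Finset.sum_empty]
        exact trace_mul_secondMoment_nonneg (by
          rw [← conjTranspose_eq_transpose_of_trivial]
          exact posSemidef_conjTranspose_mul_self _) _ _ _
      | succ t ih =>
        intro s
        rw [trace_mul_secondMoment_succ, Finset.sum_range_succ', add_zero]
        have e : Fᵀ * ((F ^ s)ᵀ * F ^ s) * F = (F ^ (s + 1))ᵀ * F ^ (s + 1) := by
          rw [pow_succ, transpose_mul]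
          noncomm_ring
        rw [e]
        have := ih (s + 1)
        simp only [add_assoc, add_comm 1] at this ⊢
        linarith
    simpa using h2 0
  have h3 := trace_mul_secondMoment_nonneg hZ F x₀ t
  rw [Matrix.sub_mul, trace_sub] at h3
  linarith

/-- Finite average cost with a positive definite cost matrix forces stability: if the partial sums
of `‖Fᵏ‖²` were unbounded, so would be the expected costs, and with them their averages. -/
lemma tendsto_pow_zero_of_bounded_average {F Z : Matrix n n ℝ} (hZ : Z.PosDef) (x₀ : n → ℝ)
    {C : ℝ} (hC : ∀ᶠ T : ℕ in atTop,
      (T : ℝ)⁻¹ * ∑ t ∈ Finset.range T, (Z * secondMoment F x₀ t).trace ≤ C) :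
    Tendsto (fun k : ℕ => F ^ k) atTop (𝓝 0) := by
  rcases isEmpty_or_nonempty n with hn | hn
  · exact tendsto_const_nhds.congr fun k => Subsingleton.elim _ _
  set c := lambdaMin Z with hcdef
  have hc : 0 < c := lambdaMin_pos_of_posDef hZ
  have hZc : (Z - c • (1 : Matrix n n ℝ)).PosSemidef := by
    refine PosSemidef.of_dotProduct_mulVec_nonneg (hZ.isHermitian.sub ?_) fun v => ?_
    · simp [IsHermitian]
    · have := lambdaMin_mul_dotProduct_le hZ.isHermitian v
      simp only [star_trivial, sub_mulVec, smul_mulVec, one_mulVec, dotProduct_sub,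
        dotProduct_smul, smul_eq_mul]
      linarith
  set f : ℕ → ℝ := fun k => ((F ^ k)ᵀ * F ^ k).trace with hf
  have hf' : ∀ k, f k = ∑ i, ∑ j, (F ^ k) j i ^ 2 := fun k => by
    simp only [hf, trace, mul_apply, sq, transpose_apply, diag_apply]
  have hf0 : ∀ k, 0 ≤ f k := fun k => by rw [hf']; positivity
  have hmono : Monotone fun t => ∑ k ∈ Finset.range t, f k :=
    monotone_nat_of_le_succ fun t => by rw [Finset.sum_range_succ]; linarith [hf0 t]
  have hlow := fun t => sum_frobenius_le_trace_mul_secondMoment hc.le hZc F x₀ t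
  obtain ⟨T₀, hT₀⟩ := eventually_atTop.1 hC
  have hb : ∀ t, ∑ k ∈ Finset.range t, f k ≤ 2 * C / c := by
    intro t
    -- average over `2 M` steps: each of the last `M` costs is at least `c ∑_{k < M} f k`
    refine (hmono (le_max_left t (T₀ + 1))).trans ?_
    set M := max t (T₀ + 1) with hM
    have hM1 : T₀ + 1 ≤ M := le_max_right _ _
    have hM0 : (0 : ℝ) < M := by exact_mod_cast (by omega : 0 < M)
    have h1 := hT₀ (M + M) (by omega)
    have h2 : (M : ℝ) * (c * ∑ k ∈ Finset.range M, f k) ≤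
        ∑ t ∈ Finset.range (M + M), (Z * secondMoment F x₀ t).trace := by
      rw [Finset.sum_range_add]
      have h3 : 0 ≤ ∑ t ∈ Finset.range M, (Z * secondMoment F x₀ t).trace :=
        Finset.sum_nonneg fun t _ => trace_mul_secondMoment_nonneg hZ.posSemidef _ _ _
      have h4 : (M : ℝ) * (c * ∑ k ∈ Finset.range M, f k) ≤
          ∑ t ∈ Finset.range M, (Z * secondMoment F x₀ (M + t)).trace := by
        have := Finset.card_nsmul_le_sum (Finset.range M)
          (fun t => (Z * secondMoment F x₀ (M + t)).trace) (c * ∑ k ∈ Finset.range M, f k)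
          fun t _ => (mul_le_mul_of_nonneg_left (hmono (Nat.le_add_right M t)) hc.le).trans
            (hlow (M + t))
        simpa using this
      linarith
    rw [inv_mul_le_iff₀ (by push_cast; linarith)] at h1
    rw [le_div_iff₀ hc]
    push_cast at h1
    have h5 : (M : ℝ) * ((∑ k ∈ Finset.range M, f k) * c) ≤ M * (2 * C) := by nlinarith
    exact le_of_mul_le_mul_left h5 hM0
  have hs := (summable_of_sum_range_le hf0 hb).tendsto_atTop_zero
  refine tendsto_pi_nhds.2 fun i => tendsto_pi_nhds.2 fun j => ?_
  have hsq : Tendsto (fun k => (F ^ k) i j ^ 2) atTop (𝓝 0) := by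
    refine squeeze_zero (fun k => sq_nonneg _) (fun k => ?_) hs
    rw [hf']
    exact (Finset.single_le_sum (f := fun j' => (F ^ k) j' j ^ 2) (fun _ _ => sq_nonneg _)
      (Finset.mem_univ i)).trans (Finset.single_le_sum (f := fun i' => ∑ j', (F ^ k) j' i' ^ 2)
      (fun _ _ => Finset.sum_nonneg fun _ _ => sq_nonneg _) (Finset.mem_univ j))
  have := hsq.sqrt
  simp only [Real.sqrt_sq_eq_abs, Real.sqrt_zero] at this
  exact (tendsto_zero_iff_abs_tendsto_zero _).2 this

lemma transpose_eq_of_lyapunov {F P Z : Matrix n n ℝ} {τ ρ : ℝ} (hρ : 0 < ρ)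
    (hF : IsExpStable F τ ρ) (hZ : Zᵀ = Z) (hP : P = Z + Fᵀ * P * F) : Pᵀ = P := by
  have h : Pᵀ - P = 0 + Fᵀ * (Pᵀ - P) * F := by
    have h1 : Pᵀ = Z + Fᵀ * Pᵀ * F := by
      conv_lhs => rw [hP]
      simp only [transpose_add, transpose_mul, transpose_transpose, hZ, Matrix.mul_assoc]
    calc Pᵀ - P = (Z + Fᵀ * Pᵀ * F) - (Z + Fᵀ * P * F) := by rw [← h1, ← hP]
      _ = 0 + Fᵀ * (Pᵀ - P) * F := by noncomm_ring
  have := norm_stein_le (C := 0) (θ := 0) hρ hF.transpose hF h le_rfl le_rfl zero_lt_one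
    (by simp)
  simp only [zero_div, norm_le_zero_iff] at this
  exact sub_eq_zero.1 this

lemma posSemidef_of_lyapunov {F P Z : Matrix n n ℝ} {τ ρ : ℝ} (hρ : 0 < ρ)
    (hF : IsExpStable F τ ρ) (hZ : Z.PosSemidef) (hP : P = Z + Fᵀ * P * F) : P.PosSemidef := by
  refine PosSemidef.of_dotProduct_mulVec_nonneg
    (transpose_eq_of_lyapunov hρ hF hZ.isHermitian hP) fun v => ?_
  rw [star_trivial]
  have h1 : ∀ J : ℕ, v ⬝ᵥ (Fᵀ ^ J * P * F ^ J) *ᵥ v ≤ v ⬝ᵥ P *ᵥ v := by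
    intro J
    conv_rhs => rw [stein_iterate hP J]
    rw [add_mulVec, dotProduct_add]
    refine le_add_of_nonneg_left ?_
    have : (∑ j ∈ Finset.range J, Fᵀ ^ j * Z * F ^ j).PosSemidef :=
      posSemidef_sum _ fun j _ => by
        rw [← transpose_pow, ← conjTranspose_eq_transpose_of_trivial]
        exact hZ.conjTranspose_mul_mul_same _
    simpa using this.dotProduct_mulVec_nonneg v
  have h2 : Tendsto (fun J : ℕ => v ⬝ᵥ (Fᵀ ^ J * P * F ^ J) *ᵥ v) atTop
      (𝓝 (v ⬝ᵥ ((0 : Matrix n n ℝ) * P * 0) *ᵥ v)) := by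
    have h3 := ((hF.transpose.tendsto_zero hρ).mul_const P).mul (hF.tendsto_zero hρ)
    have h4 : Continuous fun X : Matrix n n ℝ => v ⬝ᵥ X *ᵥ v := by fun_prop
    exact (h4.tendsto _).comp h3
  simp only [mul_zero, zero_mulVec, dotProduct_zero] at h2
  exact le_of_tendsto' h2 h1

lemma posDef_of_posDef_schur {Q : Matrix n n ℝ} {R : Matrix m m ℝ} {S : Matrix m n ℝ}
    (hQ : Q.PosDef) (hRS : (R - S * Q⁻¹ * Sᵀ).PosDef) : R.PosDef := by
  refine PosDef.of_dotProduct_mulVec_pos (transpose_eq_of_posDef_schur hQ hRS) fun u hu => ?_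
  have h1 := stageCost_eq_schur R S hQ 0 u
  have h2 := hQ.posSemidef.dotProduct_mulVec_nonneg (0 + Q⁻¹ *ᵥ (Sᵀ *ᵥ u))
  have h3 := hRS.dotProduct_mulVec_pos hu
  simp only [stageCost, mulVec_zero, dotProduct_zero, mul_zero, add_zero,
    zero_add] at h1 h2
  rw [star_trivial] at h2 h3 ⊢
  linarith

/-- Completing the square in the gain: with `W = R + BᵀPB` and `W K' = BᵀPA + S`, the Bellman
quadratic form of `K` exceeds that of `K'` by `(K - K')ᵀ W (K - K')`. -/
lemma bellman_gain_sub {A Q P : Matrix n n ℝ} {B : Matrix n m ℝ} {R : Matrix m m ℝ}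
    {S K K' : Matrix m n ℝ} (hP : Pᵀ = P) (hR : Rᵀ = R)
    (hK' : (R + Bᵀ * P * B) * K' = Bᵀ * P * A + S) :
    gainCost Q R S K + (A - B * K)ᵀ * P * (A - B * K) =
      gainCost Q R S K' + (K - K')ᵀ * (R + Bᵀ * P * B) * (K - K') +
        (A - B * K')ᵀ * P * (A - B * K') := by
  have h : ∀ G : Matrix m n ℝ, gainCost Q R S G + (A - B * G)ᵀ * P * (A - B * G) =
      Q + Aᵀ * P * A - Gᵀ * (Bᵀ * P * A + S) - (Bᵀ * P * A + S)ᵀ * G +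
        Gᵀ * (R + Bᵀ * P * B) * G := by
    intro G
    simp only [gainCost, transpose_sub, transpose_add, transpose_mul, transpose_transpose, hP,
      Matrix.mul_sub, Matrix.sub_mul, Matrix.mul_add, Matrix.add_mul, Matrix.mul_assoc]
    abel
  have hW : (R + Bᵀ * P * B)ᵀ = R + Bᵀ * P * B := by
    simp only [transpose_add, transpose_mul, transpose_transpose, hP, hR, Matrix.mul_assoc]
  have e : gainCost Q R S K' + (K - K')ᵀ * (R + Bᵀ * P * B) * (K - K') +
      (A - B * K')ᵀ * P * (A - B * K') = (gainCost Q R S K' + (A - B * K')ᵀ * P * (A - B * K')) +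
      (K - K')ᵀ * (R + Bᵀ * P * B) * (K - K') := by abel
  rw [e, h, h, ← hK', transpose_mul, hW]
  generalize R + Bᵀ * P * B = W
  simp only [transpose_sub, Matrix.mul_sub, Matrix.sub_mul, Matrix.mul_assoc]
  abel

lemma eq_zero_of_trace_quadratic_eq_zero {W : Matrix m m ℝ} (hW : W.PosDef) {E : Matrix m n ℝ}
    (h : (Eᵀ * W * E).trace = 0) : E = 0 := by
  have hE : (Eᵀ * W * E).PosSemidef := by
    rw [← conjTranspose_eq_transpose_of_trivial]
    exact hW.posSemidef.conjTranspose_mul_mul_same E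
  rw [hE.trace_eq_zero_iff] at h
  have h1 : ∀ x, E *ᵥ x = 0 := by
    intro x
    by_contra hx
    have h2 := hW.dotProduct_mulVec_pos hx
    have h3 : (E *ᵥ x) ⬝ᵥ W *ᵥ (E *ᵥ x) = x ⬝ᵥ (Eᵀ * W * E) *ᵥ x := by
      rw [← mulVec_mulVec, ← mulVec_mulVec, dotProduct_mulVec x, vecMul_transpose]
    rw [star_trivial, h3, h] at h2
    simp at h2
  exact ext_of_mulVec_single fun i => by rw [h1, zero_mulVec]

variable [MeasurableSpace Ω] {μ : Measure Ω} [IsProbabilityMeasure μ] {w : ℕ → Ω → (n → ℝ)}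

lemma averageCost_of_stable (hw : IsStandardGaussianNoise μ w)
    {Q : Matrix n n ℝ} {R : Matrix m m ℝ} {S : Matrix m n ℝ} (hQ : Q.PosDef)
    (hRS : (R - S * Q⁻¹ * Sᵀ).PosDef) {A : Matrix n n ℝ} {B : Matrix n m ℝ} {K : Matrix m n ℝ}
    {τ ρ : ℝ} (hρ : 0 < ρ) (hF : IsExpStable (A - B * K) τ ρ) {P : Matrix n n ℝ}
    (hP : P = gainCost Q R S K + (A - B * K)ᵀ * P * (A - B * K)) (x₀ : n → ℝ) :
    averageCost μ Q R S (feedbackState A B K x₀ w)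
      (fun t ω => -(K *ᵥ feedbackState A B K x₀ w t ω)) = ENNReal.ofReal P.trace := by
  rw [averageCost_feedback hw hQ hRS]
  exact (ENNReal.tendsto_ofReal (tendsto_average_trace hρ hF hP x₀)).limsup_eq

/-- Every feedback law is causal, so an optimal gain is at least as good as any other
gain, stabilizing or not. -/
lemma IsOptimalGain.le_feedback {x₀ : n → ℝ} {A Q : Matrix n n ℝ} {B : Matrix n m ℝ}
    {R : Matrix m m ℝ} {S K : Matrix m n ℝ} (hK : IsOptimalGain μ w x₀ A B Q R S K)
    (K' : Matrix m n ℝ) :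
    averageCost μ Q R S (feedbackState A B K x₀ w)
      (fun t ω => -(K *ᵥ feedbackState A B K x₀ w t ω)) ≤
    averageCost μ Q R S (feedbackState A B K' x₀ w)
      (fun t ω => -(K' *ᵥ feedbackState A B K' x₀ w t ω)) := by
  have := hK _ (isCausalControl_feedback A B K' x₀ w)
  rwa [feedbackState_eq_lqrState] at this

/-- An optimal gain is stabilizing, because its average cost is at most that of the zero gain, which
is finite for stable `A`. -/
lemma IsOptimalGain.tendsto_pow_zero (hw : IsStandardGaussianNoise μ w) {x₀ : n → ℝ}
    {A Q : Matrix n n ℝ} {B : Matrix n m ℝ} {R : Matrix m m ℝ} {S K : Matrix m n ℝ}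
    (hQ : Q.PosDef) (hRS : (R - S * Q⁻¹ * Sᵀ).PosDef)
    (hA : Tendsto (fun k : ℕ => A ^ k) atTop (𝓝 0)) (hK : IsOptimalGain μ w x₀ A B Q R S K) :
    Tendsto (fun k : ℕ => (A - B * K) ^ k) atTop (𝓝 0) := by
  obtain ⟨τ, ρ, -, hρ, hAs⟩ := exists_isExpStable hA
  obtain ⟨P₀, hP₀⟩ := exists_stein hρ hAs.transpose hAs (gainCost Q R S 0)
  have hA0 : A - B * (0 : Matrix m n ℝ) = A := by simp
  have h1 := hK.le_feedback 0
  rw [averageCost_of_stable (K := 0) hw hQ hRS (P := P₀) hρ (by rwa [hA0]) (by rwa [hA0]) x₀,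
    averageCost_feedback hw hQ hRS] at h1
  have hlt : ENNReal.ofReal P₀.trace < ENNReal.ofReal (|P₀.trace| + 1) :=
    (ENNReal.ofReal_lt_ofReal_iff (by positivity)).2 (by linarith [le_abs_self P₀.trace])
  have h2 := eventually_lt_of_limsup_lt (h1.trans_lt hlt)
  refine tendsto_pow_zero_of_bounded_average (gainCost_posDef hQ hRS K) x₀
    (C := |P₀.trace| + 1) (h2.mono fun T hT => ?_)
  exact (ENNReal.ofReal_le_ofReal_iff (by positivity)).1 hT.le

/-- The Riccati equation of a stabilizing optimal gain `K`, in costate form. It says that `K` is the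
greedy gain `K'` for its own cost matrix `P`, which follows by comparing the two average costs.
That `K'` is stabilizing is not used: only an upper bound for its average cost is needed, and there
the terminal term has a sign. -/
theorem IsOptimalGain.riccati (hw : IsStandardGaussianNoise μ w) {x₀ : n → ℝ}
    {A Q : Matrix n n ℝ} {B : Matrix n m ℝ} {R : Matrix m m ℝ} {S K : Matrix m n ℝ}
    (hQ : Q.PosDef) (hRS : (R - S * Q⁻¹ * Sᵀ).PosDef) {τ ρ : ℝ} (hρ : 0 < ρ)
    (hF : IsExpStable (A - B * K) τ ρ) (hK : IsOptimalGain μ w x₀ A B Q R S K) :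
    ∃ P : Matrix n n ℝ, P = Q - Sᵀ * K + Aᵀ * P * (A - B * K) ∧
      R * K = S + Bᵀ * P * (A - B * K) := by
  obtain ⟨P, hP⟩ := exists_stein hρ hF.transpose hF (gainCost Q R S K)
  have hZ := gainCost_posDef hQ hRS K
  have hPs := posSemidef_of_lyapunov hρ hF hZ.posSemidef hP
  have hPt : Pᵀ = P := hPs.isHermitian
  have hW : (R + Bᵀ * P * B).PosDef := by
    refine (posDef_of_posDef_schur hQ hRS).add_posSemidef ?_
    rw [← conjTranspose_eq_transpose_of_trivial]
    exact hPs.conjTranspose_mul_mul_same B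
  set W := R + Bᵀ * P * B with hWdef
  obtain ⟨K', hK'⟩ : ∃ K', W * K' = Bᵀ * P * A + S :=
    ⟨W⁻¹ * (Bᵀ * P * A + S), mul_nonsing_inv_cancel_left _ _
      ((isUnit_iff_isUnit_det _).1 hW.isUnit)⟩
  set V := (K - K')ᵀ * W * (K - K') with hV
  have hVs : V.PosSemidef := by
    rw [hV, ← conjTranspose_eq_transpose_of_trivial]
    exact hW.posSemidef.conjTranspose_mul_mul_same _
  have hB : P = gainCost Q R S K' + V + (A - B * K')ᵀ * P * (A - B * K') :=
    hP.trans (bellman_gain_sub hPt (transpose_eq_of_posDef_schur hQ hRS) hK')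
  have hKK : K = K' := by
    have h1 := hK.le_feedback K'
    rw [averageCost_of_stable hw hQ hRS hρ hF hP, averageCost_feedback hw hQ hRS] at h1
    -- from time 1 on, the noise alone makes the expected defect at least `trace V`
    have h2 : ∀ T : ℕ, 0 < T → (T : ℝ)⁻¹ * ∑ t ∈ Finset.range T,
        (gainCost Q R S K' * secondMoment (A - B * K') x₀ t).trace ≤
        (T : ℝ)⁻¹ * ((P * secondMoment (A - B * K') x₀ 0).trace + V.trace) +
          (P.trace - V.trace) := by
      intro T hT
      have hT' : (0 : ℝ) < T := by exact_mod_cast hT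
      have h3 := trace_mul_secondMoment_nonneg hPs (A - B * K') x₀ T
      have h4 : (T - 1 : ℝ) * V.trace ≤
          ∑ t ∈ Finset.range T, (V * secondMoment (A - B * K') x₀ t).trace := by
        obtain ⟨T, rfl⟩ := Nat.exists_eq_succ_of_ne_zero hT.ne'
        rw [Finset.sum_range_succ']
        have h5 := trace_mul_secondMoment_nonneg hVs (A - B * K') x₀ 0
        have h6 : ∀ t ∈ Finset.range T, V.trace ≤
            (V * secondMoment (A - B * K') x₀ (t + 1)).trace := fun t _ => by
          rw [trace_mul_secondMoment_succ]
          refine le_add_of_nonneg_left (trace_mul_secondMoment_nonneg ?_ _ _ _)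
          rw [← conjTranspose_eq_transpose_of_trivial]
          exact hVs.conjTranspose_mul_mul_same _
        have h7 := Finset.card_nsmul_le_sum _ _ _ h6
        simp only [Finset.card_range, nsmul_eq_mul] at h7
        push_cast
        linarith
      rw [sum_trace_mul_secondMoment hB, inv_mul_le_iff₀ hT', mul_add, mul_inv_cancel_left₀ hT'.ne']
      linarith
    have h3 : Tendsto (fun T : ℕ => (T : ℝ)⁻¹ *
        ((P * secondMoment (A - B * K') x₀ 0).trace + V.trace) + (P.trace - V.trace)) atTop
        (𝓝 (0 * ((P * secondMoment (A - B * K') x₀ 0).trace + V.trace) +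
          (P.trace - V.trace))) :=
      (tendsto_inv_atTop_nhds_zero_nat.mul_const _).add_const _
    rw [zero_mul, zero_add] at h3
    have h4 := h1.trans (limsup_le_limsup ((eventually_gt_atTop 0).mono fun T hT =>
      ENNReal.ofReal_le_ofReal (h2 T hT)))
    rw [(ENNReal.tendsto_ofReal h3).limsup_eq] at h4
    have h5 : 0 ≤ P.trace - V.trace := by
      rw [← trace_sub]
      refine PosSemidef.trace_nonneg ?_
      have e : P - V = gainCost Q R S K' + (A - B * K')ᵀ * P * (A - B * K') := by
        rw [sub_eq_iff_eq_add]
        conv_lhs => rw [hB]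
        abel
      rw [e, ← conjTranspose_eq_transpose_of_trivial]
      exact (gainCost_posDef hQ hRS K').posSemidef.add (hPs.conjTranspose_mul_mul_same _)
    have h6 := (ENNReal.ofReal_le_ofReal_iff h5).1 h4
    exact sub_eq_zero.1 (eq_zero_of_trace_quadratic_eq_zero hW
      (le_antisymm (by linarith) hVs.trace_nonneg))
  rw [← hKK] at hK'
  have hRK : R * K = S + Bᵀ * P * (A - B * K) := by
    have e : R * K = W * K - Bᵀ * P * B * K := by
      rw [hWdef, Matrix.add_mul]; abel
    rw [e, hK', Matrix.mul_sub, Matrix.mul_assoc _ B K]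
    abel
  refine ⟨P, ?_, hRK⟩
  have e : (A - B * K)ᵀ * P * (A - B * K) =
      Aᵀ * P * (A - B * K) - Kᵀ * (Bᵀ * P * (A - B * K)) := by
    rw [transpose_sub, transpose_mul]
    simp only [Matrix.sub_mul, Matrix.mul_assoc]
  rw [e, gainCost, Matrix.mul_assoc Kᵀ R K, hRK, Matrix.mul_add] at hP
  conv_lhs => rw [hP]
  abel

end Optimality

/-! ### Blocks of vectors and matrices -/

section Blocks

lemma norm_toEuclideanLin_le {n m : Type*} [Fintype n] [DecidableEq n] [Fintype m]
    (X : Matrix m n ℝ) (v : EuclideanSpace ℝ n) : ‖toEuclideanLin X v‖ ≤ ‖X‖ * ‖v‖ :=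
  l2_opNorm_mulVec X v

lemma norm_le_of_forall_toEuclideanLin {n m : Type*} [Fintype n] [DecidableEq n] [Fintype m]
    {X : Matrix m n ℝ} {C : ℝ} (hC : 0 ≤ C) (h : ∀ v, ‖toEuclideanLin X v‖ ≤ C * ‖v‖) :
    ‖X‖ ≤ C :=
  ContinuousLinearMap.opNorm_le_bound _ hC h

variable {N : ℕ} {n m p : Fin N → ℕ}

/-- The local part of agent `i` of a stacked vector. -/
def blockPart (i : Fin N) : EuclideanSpace ℝ (BlockIdx n) →ₗ[ℝ] EuclideanSpace ℝ (Fin (n i)) where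
  toFun v := WithLp.toLp 2 fun k => v ⟨i, k⟩
  map_add' _ _ := rfl
  map_smul' _ _ := rfl

@[simp] lemma blockPart_apply (i : Fin N) (v : EuclideanSpace ℝ (BlockIdx n)) (k : Fin (n i)) :
    blockPart i v k = v ⟨i, k⟩ := rfl

/-- The stacked vector with local part `y` at agent `j` and zero elsewhere. -/
def blockSingle (j : Fin N) (y : EuclideanSpace ℝ (Fin (n j))) : EuclideanSpace ℝ (BlockIdx n) :=
  WithLp.toLp 2 fun p => if h : p.1 = j then y (Fin.cast (by rw [h]) p.2) else 0

lemma norm_sq_eq_sum_blockPart (v : EuclideanSpace ℝ (BlockIdx n)) :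
    ‖v‖ ^ 2 = ∑ i, ‖blockPart i v‖ ^ 2 := by
  simp only [EuclideanSpace.norm_sq_eq, Fintype.sum_sigma]
  rfl

lemma norm_blockPart_le (i : Fin N) (v : EuclideanSpace ℝ (BlockIdx n)) :
    ‖blockPart i v‖ ≤ ‖v‖ := by
  refine (sq_le_sq₀ (norm_nonneg _) (norm_nonneg _)).1 ?_
  rw [norm_sq_eq_sum_blockPart v]
  exact Finset.single_le_sum (f := fun i => ‖blockPart i v‖ ^ 2) (fun _ _ => sq_nonneg _)
    (Finset.mem_univ i)

lemma blockPart_blockSingle_self (j : Fin N) (y : EuclideanSpace ℝ (Fin (n j))) :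
    blockPart j (blockSingle j y) = y := by
  ext k
  simp [blockSingle]

lemma blockPart_blockSingle_of_ne {i j : Fin N} (h : i ≠ j) (y : EuclideanSpace ℝ (Fin (n j))) :
    blockPart i (blockSingle j y) = 0 := by
  ext k
  simp [blockSingle, h]

lemma norm_blockSingle (j : Fin N) (y : EuclideanSpace ℝ (Fin (n j))) :
    ‖blockSingle j y‖ = ‖y‖ := by
  refine (sq_eq_sq₀ (norm_nonneg _) (norm_nonneg _)).1 ?_
  rw [norm_sq_eq_sum_blockPart, Finset.sum_eq_single j, blockPart_blockSingle_self]
  · intro i _ hi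
    simp [blockPart_blockSingle_of_ne hi]
  · simp

lemma blockPart_toEuclideanLin (X : Matrix (BlockIdx n) (BlockIdx m) ℝ) (i : Fin N)
    (v : EuclideanSpace ℝ (BlockIdx m)) :
    blockPart i (toEuclideanLin X v) =
      ∑ k, toEuclideanLin (blockOf X i k) (blockPart k v) := by
  ext l
  simp only [WithLp.ofLp_sum, Finset.sum_apply]
  simp only [blockPart_apply, toLpLin_apply, mulVec, dotProduct, Fintype.sum_sigma, blockOf,
    submatrix_apply]

lemma toEuclideanLin_blockOf (X : Matrix (BlockIdx n) (BlockIdx m) ℝ) (i j : Fin N)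
    (y : EuclideanSpace ℝ (Fin (m j))) :
    toEuclideanLin (blockOf X i j) y = blockPart i (toEuclideanLin X (blockSingle j y)) := by
  rw [blockPart_toEuclideanLin, Finset.sum_eq_single j, blockPart_blockSingle_self]
  · intro k _ hk
    rw [blockPart_blockSingle_of_ne hk, map_zero]
  · simp

lemma norm_blockOf_le (X : Matrix (BlockIdx n) (BlockIdx m) ℝ) (i j : Fin N) :
    ‖blockOf X i j‖ ≤ ‖X‖ := by
  refine norm_le_of_forall_toEuclideanLin (norm_nonneg _) fun y => ?_
  rw [toEuclideanLin_blockOf, ← norm_blockSingle j y]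
  exact (norm_blockPart_le _ _).trans (norm_toEuclideanLin_le _ _)

lemma blockOf_add (X Y : Matrix (BlockIdx n) (BlockIdx m) ℝ) (i j : Fin N) :
    blockOf (X + Y) i j = blockOf X i j + blockOf Y i j := rfl

lemma blockOf_sum {ι : Type*} (s : Finset ι) (X : ι → Matrix (BlockIdx n) (BlockIdx m) ℝ)
    (i j : Fin N) : blockOf (∑ k ∈ s, X k) i j = ∑ k ∈ s, blockOf (X k) i j := by
  ext
  simp [blockOf, Matrix.sum_apply]

lemma blockOf_transpose (X : Matrix (BlockIdx n) (BlockIdx m) ℝ) (i j : Fin N) :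
    blockOf Xᵀ i j = (blockOf X j i)ᵀ := rfl

lemma blockOf_mul (X : Matrix (BlockIdx n) (BlockIdx m) ℝ) (Y : Matrix (BlockIdx m) (BlockIdx p) ℝ)
    (i j : Fin N) : blockOf (X * Y) i j = ∑ k, blockOf X i k * blockOf Y k j := by
  ext
  simp [blockOf, mul_apply, Fintype.sum_sigma, Matrix.sum_apply]

end Blocks

/-! ### Algebra of spatially exponentially decaying matrices -/

section SED

variable {N : ℕ} {n m p : Fin N → ℕ} {d : Fin N → Fin N → ℝ}

lemma IsSED.mono {X : Matrix (BlockIdx n) (BlockIdx m) ℝ} {c c' γ γ' : ℝ} (hd : IsAgentDistance d)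
    (h : IsSED d X c γ) (hc : c ≤ c') (hc0 : 0 ≤ c') (hγ : γ' ≤ γ) : IsSED d X c' γ' := by
  intro i j
  refine (h i j).trans (mul_le_mul hc (Real.exp_le_exp.2 ?_) (Real.exp_pos _).le hc0)
  nlinarith [hd.nonneg i j]

lemma IsSED.transpose {X : Matrix (BlockIdx n) (BlockIdx m) ℝ} {c γ : ℝ} (hd : IsAgentDistance d)
    (h : IsSED d X c γ) : IsSED d Xᵀ c γ := by
  intro i j
  rw [blockOf_transpose, norm_transpose_eq, hd.symm i j]
  exact h j i

lemma IsSED.add {X Y : Matrix (BlockIdx n) (BlockIdx m) ℝ} {c c' γ : ℝ}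
    (hX : IsSED d X c γ) (hY : IsSED d Y c' γ) : IsSED d (X + Y) (c + c') γ := by
  intro i j
  rw [blockOf_add, add_mul]
  exact (norm_add_le _ _).trans (add_le_add (hX i j) (hY i j))

lemma IsSED.mul {X : Matrix (BlockIdx n) (BlockIdx m) ℝ} {Y : Matrix (BlockIdx m) (BlockIdx p) ℝ}
    {c c' γ : ℝ} (hd : IsAgentDistance d) (hc : 0 ≤ c) (hc' : 0 ≤ c') (hγ : 0 ≤ γ)
    (hX : IsSED d X c γ) (hY : IsSED d Y c' γ) : IsSED d (X * Y) (c * c' * N) γ := by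
  intro i j
  rw [blockOf_mul]
  refine (norm_sum_le_of_le (f := fun k => blockOf X i k * blockOf Y k j) Finset.univ
    (n := fun _ => c * c' * Real.exp (-γ * d i j)) fun k _ => ?_).trans (le_of_eq ?_)
  · calc ‖blockOf X i k * blockOf Y k j‖ ≤ ‖blockOf X i k‖ * ‖blockOf Y k j‖ := l2_opNorm_mul _ _
      _ ≤ (c * Real.exp (-γ * d i k)) * (c' * Real.exp (-γ * d k j)) := by
          gcongr
          · exact hX i k
          · exact hY k j
      _ = c * c' * Real.exp (-γ * (d i k + d k j)) := by
          rw [mul_add, Real.exp_add]; ring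
      _ ≤ c * c' * Real.exp (-γ * d i j) := by
          have := hd.triangle i j k
          gcongr ?_ * Real.exp ?_
          nlinarith
  · rw [Finset.sum_const, Finset.card_univ, Fintype.card_fin, nsmul_eq_mul]
    ring

lemma IsSED.mul_pow {X : Matrix (BlockIdx m) (BlockIdx n) ℝ}
    {A : Matrix (BlockIdx n) (BlockIdx n) ℝ} {c a γ : ℝ} (hd : IsAgentDistance d) (hc : 0 ≤ c)
    (ha : 0 ≤ a) (hγ : 0 ≤ γ) (hX : IsSED d X c γ) (hA : IsSED d A a γ) (k : ℕ) :
    IsSED d (X * A ^ k) (c * (a * N) ^ k) γ := by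
  induction k with
  | zero => simpa using hX
  | succ k ih =>
    rw [pow_succ, ← Matrix.mul_assoc]
    have := ih.mul hd (by positivity) ha hγ hA
    convert! this using 1
    ring

lemma IsSED.pow_mul {X : Matrix (BlockIdx n) (BlockIdx m) ℝ}
    {A : Matrix (BlockIdx n) (BlockIdx n) ℝ} {c a γ : ℝ} (hd : IsAgentDistance d) (hc : 0 ≤ c)
    (ha : 0 ≤ a) (hγ : 0 ≤ γ) (hX : IsSED d X c γ) (hA : IsSED d A a γ) (k : ℕ) :
    IsSED d (A ^ k * X) (c * (a * N) ^ k) γ := by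
  induction k with
  | zero => simpa using hX
  | succ k ih =>
    rw [pow_succ', Matrix.mul_assoc]
    have := hA.mul hd ha (by positivity) hγ ih
    convert! this using 1
    ring

/-- Growth `y^ℓ e^{-γδ}` is beaten by `e^{-γ'δ}` up to the crossover time
`κ = γδ / (ρ + log y)`, where `γ' = γρ / (ρ + log y)`. -/
lemma pow_mul_exp_le_of_le_crossover {y ρ γ δ : ℝ} (hy : 1 ≤ y) (hρ : 0 < ρ) {l : ℕ}
    (hl : (l : ℝ) ≤ γ * δ / (ρ + Real.log y)) :
    y ^ l * Real.exp (-γ * δ) ≤ Real.exp (-(γ * ρ / (ρ + Real.log y)) * δ) := by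
  have hlog := Real.log_nonneg hy
  have hs : 0 < ρ + Real.log y := by linarith
  have e : y ^ l = Real.exp (l * Real.log y) := by
    rw [Real.exp_nat_mul, Real.exp_log (by linarith)]
  rw [e, ← Real.exp_add, Real.exp_le_exp]
  have h1 := mul_le_mul_of_nonneg_right hl hlog
  have h2 : γ * δ / (ρ + Real.log y) * Real.log y + -γ * δ =
      -(γ * ρ / (ρ + Real.log y)) * δ := by
    field_simp
    ring
  linarith

lemma exp_le_of_crossover_le {y ρ γ δ : ℝ} (hρ : 0 < ρ) {l : ℕ}
    (hl : γ * δ / (ρ + Real.log y) ≤ l) :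
    Real.exp (-ρ * l) ≤ Real.exp (-(γ * ρ / (ρ + Real.log y)) * δ) := by
  rw [Real.exp_le_exp]
  have h1 := mul_le_mul_of_nonneg_left hl hρ.le
  have h2 : ρ * (γ * δ / (ρ + Real.log y)) = γ * ρ / (ρ + Real.log y) * δ := by ring
  linarith

/-- Powers of `A` may grow in the decay estimate, like `(aN)ᵏ`, but are small in norm for large `k`;
choosing between the two bounds at the crossover time gives one estimate for all `k`. -/
lemma IsSED.mul_pow_of_stable {X : Matrix (BlockIdx m) (BlockIdx n) ℝ}
    {A : Matrix (BlockIdx n) (BlockIdx n) ℝ} {c a γ τ ρ : ℝ} (hd : IsAgentDistance d)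
    (hc : 0 ≤ c) (ha : 1 ≤ a) (hγ : 0 ≤ γ) (hρ : 0 < ρ) (hX : IsSED d X c γ)
    (hA : IsSED d A a γ) (hAs : IsExpStable A τ ρ) (k : ℕ) :
    IsSED d (X * A ^ k) (c + τ * ‖X‖) (γ * ρ / (ρ + Real.log (a * N))) := by
  intro i j
  have hτ : 0 ≤ τ := by simpa using (norm_nonneg _).trans (hAs 0)
  have hN : (1 : ℝ) ≤ N := by exact_mod_cast (Fin.pos i)
  have hy : 1 ≤ a * N := one_le_mul_of_one_le_of_one_le ha hN
  have hE := (Real.exp_pos (-(γ * ρ / (ρ + Real.log (a * N))) * d i j)).le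
  rcases le_total (k : ℝ) (γ * d i j / (ρ + Real.log (a * N))) with hk | hk
  · refine (IsSED.mul_pow hd hc (by linarith) hγ hX hA k i j).trans ?_
    have := mul_le_mul_of_nonneg_left (pow_mul_exp_le_of_le_crossover hy hρ hk) hc
    rw [mul_assoc]
    nlinarith [mul_nonneg (mul_nonneg hτ (norm_nonneg X)) hE]
  · refine (norm_blockOf_le _ i j).trans ((l2_opNorm_mul _ _).trans ?_)
    have h1 := (hAs k).trans (mul_le_mul_of_nonneg_left (exp_le_of_crossover_le hρ hk) hτ)
    have h2 := mul_le_mul_of_nonneg_left h1 (norm_nonneg X)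
    nlinarith [mul_nonneg hc hE]

lemma norm_pow_mul_mul_pow_le {n : Type*} [Fintype n] [DecidableEq n] {F G : Matrix n n ℝ}
    {τ ρ : ℝ} (hF : IsExpStable F τ ρ) (hG : IsExpStable G τ ρ) (Q : Matrix n n ℝ) (k l : ℕ) :
    ‖F ^ k * Q * G ^ l‖ ≤ τ ^ 2 * ‖Q‖ * Real.exp (-ρ * (k + l : ℕ)) := by
  have hτ : 0 ≤ τ := by simpa using (norm_nonneg _).trans (hF 0)
  calc ‖F ^ k * Q * G ^ l‖ ≤ ‖F ^ k‖ * ‖Q‖ * ‖G ^ l‖ :=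
        (norm_mul_le _ _).trans (by gcongr; exact norm_mul_le _ _)
    _ ≤ (τ * Real.exp (-ρ * k)) * ‖Q‖ * (τ * Real.exp (-ρ * l)) := by
        gcongr
        · exact hF k
        · exact hG l
    _ = _ := by
        push_cast
        rw [mul_add, Real.exp_add]
        ring

/-- The outer powers are put inside the series for `P`, so that `τ` enters only to the power 2. -/
lemma norm_pow_mul_stein_mul_pow_le {n : Type*} [Fintype n] [DecidableEq n] {F G P Q : Matrix n n ℝ}
    {τ ρ : ℝ} (hρ : 0 < ρ) (hF : IsExpStable F τ ρ) (hG : IsExpStable G τ ρ)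
    (hP : P = Q + F * P * G) (k l : ℕ) :
    ‖F ^ k * P * G ^ l‖ ≤
      τ ^ 2 * ‖Q‖ / (1 - Real.exp (-2 * ρ)) * Real.exp (-ρ * (k + l : ℕ)) := by
  have hX : F ^ k * P * G ^ l = F ^ k * Q * G ^ l + F * (F ^ k * P * G ^ l) * G := by
    have e : F * (F ^ k * P * G ^ l) * G = F ^ k * (F * P * G) * G ^ l := by
      calc _ = (F * F ^ k) * P * (G ^ l * G) := by noncomm_ring
        _ = (F ^ k * F) * P * (G * G ^ l) := by
          rw [(Commute.self_pow F k).eq, (Commute.pow_self G l).eq]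
        _ = _ := by noncomm_ring
    rw [e, ← Matrix.add_mul, ← Matrix.mul_add, ← hP]
  have h1 := norm_stein_le (C := τ ^ 2 * ‖Q‖ * Real.exp (-ρ * (k + l : ℕ)))
    (θ := Real.exp (-2 * ρ)) hρ hF hG hX (by positivity) (Real.exp_pos _).le
    (Real.exp_lt_one_iff.2 (by linarith)) fun j => by
      have e : F ^ j * (F ^ k * Q * G ^ l) * G ^ j = F ^ (j + k) * Q * G ^ (l + j) := by
        rw [pow_add, pow_add]; noncomm_ring
      rw [e]
      refine (norm_pow_mul_mul_pow_le hF hG Q _ _).trans (le_of_eq ?_)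
      rw [← Real.exp_nat_mul, mul_assoc (τ ^ 2 * ‖Q‖), ← Real.exp_add]
      congr 2
      push_cast
      ring
  refine h1.trans (le_of_eq ?_)
  ring

lemma sum_pow_le_two_mul_pow {z : ℝ} (hz : 2 ≤ z) (J : ℕ) :
    ∑ j ∈ Finset.range (J + 1), z ^ j ≤ 2 * z ^ J := by
  induction J with
  | zero => simp
  | succ J ih =>
    rw [Finset.sum_range_succ]
    have : 0 ≤ z ^ J := by positivity
    rw [pow_succ]
    nlinarith

/-- The Lyapunov series `P Aᵏ = ∑ⱼ (Aᵀ)ʲ Q Aʲ⁺ᵏ` is cut at the crossover time: earlier terms decay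
in space because few factors `A` occur, later ones are small because `A` is stable. -/
lemma IsSED.lyapunov_mul_pow {A P Q : Matrix (BlockIdx n) (BlockIdx n) ℝ} {a q γ τ ρ : ℝ}
    (hd : IsAgentDistance d) (hq : 0 ≤ q) (ha : 1 ≤ a) (hγ : 0 ≤ γ) (hρ : 0 < ρ)
    (hQ : IsSED d Q q γ) (hA : IsSED d A a γ) (hAs : IsExpStable A τ ρ)
    (hP : P = Q + Aᵀ * P * A) (k : ℕ) :
    IsSED d (P * A ^ k) (τ ^ 2 * ‖Q‖ / (1 - Real.exp (-2 * ρ)) + 2 * q)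
      (γ * ρ / (ρ + Real.log (a * N))) := by
  intro i j
  have hθ : 0 < 1 - Real.exp (-2 * ρ) := sub_pos.2 (Real.exp_lt_one_iff.2 (by linarith))
  set C := τ ^ 2 * ‖Q‖ / (1 - Real.exp (-2 * ρ)) with hC
  have hC0 : 0 ≤ C := by positivity
  have hN : (1 : ℝ) ≤ N := by exact_mod_cast (Fin.pos i)
  have hy : 1 ≤ a * N := one_le_mul_of_one_le_of_one_le ha hN
  set κ := γ * d i j / (ρ + Real.log (a * N)) with hκ
  have hE := (Real.exp_pos (-(γ * ρ / (ρ + Real.log (a * N))) * d i j)).le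
  have htail : ∀ J l : ℕ, κ ≤ (J + l : ℕ) → ‖blockOf (Aᵀ ^ J * P * A ^ l) i j‖ ≤
      C * Real.exp (-(γ * ρ / (ρ + Real.log (a * N))) * d i j) := fun J l h =>
    (norm_blockOf_le _ i j).trans ((norm_pow_mul_stein_mul_pow_le hρ hAs.transpose hAs hP J l).trans
      (mul_le_mul_of_nonneg_left (exp_le_of_crossover_le hρ h) hC0))
  rcases lt_or_ge κ k with hk | hk
  · have := htail 0 k (by simpa using hk.le)
    rw [pow_zero, Matrix.one_mul] at this
    nlinarith
  -- two distinct agents give `a N ≥ 2`, so that the sum of powers is at most twice its last term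
  by_cases hij : i = j
  · have hd0 : d i j = 0 := by rw [hij, hd.self]
    have := htail 0 k (by rw [hκ, hd0]; simp)
    rw [pow_zero, Matrix.one_mul] at this
    nlinarith
  have hN2 : (2 : ℝ) ≤ N := by
    have h1 := i.isLt
    have h2 := j.isLt
    have h3 : (i : ℕ) ≠ j := fun h => hij (Fin.ext h)
    exact_mod_cast (by omega : 2 ≤ N)
  have hy2 : 2 ≤ a * N := by nlinarith
  set J := ⌊(κ - k) / 2⌋₊ with hJ
  have hJ1 : ((J + (J + k) : ℕ) : ℝ) ≤ κ := by
    have := Nat.floor_le (show 0 ≤ (κ - k) / 2 by linarith)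
    push_cast
    linarith
  have hJ2 : κ ≤ ((J + 1 + (J + 1 + k) : ℕ) : ℝ) := by
    have := Nat.lt_floor_add_one ((κ - k) / 2)
    push_cast
    linarith
  have hsum : P * A ^ k = ∑ l ∈ Finset.range (J + 1), Aᵀ ^ l * Q * A ^ (l + k) +
      Aᵀ ^ (J + 1) * P * A ^ (J + 1 + k) := by
    conv_lhs => rw [stein_iterate hP (J + 1)]
    rw [Matrix.add_mul, Finset.sum_mul]
    simp only [pow_add, Matrix.mul_assoc]
  rw [hsum, blockOf_add, blockOf_sum]
  have h1 : ‖∑ l ∈ Finset.range (J + 1), blockOf (Aᵀ ^ l * Q * A ^ (l + k)) i j‖ ≤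
      2 * q * Real.exp (-(γ * ρ / (ρ + Real.log (a * N))) * d i j) := by
    refine (norm_sum_le_of_le _ (n := fun l => q * (a * N) ^ k * Real.exp (-γ * d i j) *
      ((a * N) ^ 2) ^ l) fun l _ => ?_).trans ?_
    · refine (IsSED.mul_pow hd (by positivity) (by linarith) hγ (IsSED.pow_mul hd hq (by linarith)
        hγ hQ (hA.transpose hd) l) hA (l + k) i j).trans (le_of_eq ?_)
      rw [pow_add, ← _root_.pow_mul, Nat.two_mul, pow_add]
      ring
    · rw [← Finset.mul_sum]
      refine (mul_le_mul_of_nonneg_left (sum_pow_le_two_mul_pow (by nlinarith) J)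
        (by positivity)).trans ?_
      have := mul_le_mul_of_nonneg_left (pow_mul_exp_le_of_le_crossover hy hρ hJ1)
        (show 0 ≤ 2 * q by linarith)
      refine le_trans (le_of_eq ?_) this
      rw [pow_add, pow_add, ← _root_.pow_mul, Nat.two_mul, pow_add]
      ring
  refine (norm_add_le _ _).trans ?_
  rw [add_mul, add_comm (C * _)]
  exact add_le_add h1 (htail _ _ hJ2)

end SED

/-! ### The Toeplitz form of the cost as a function of the control sequence -/

section Toeplitz

variable {n m : Type*} [Fintype n] [DecidableEq n] [Fintype m] [DecidableEq m]

/-- Block Toeplitz matrix, indexed by times `t, s`, with diagonal blocks `W` and block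
`L Aᵗ⁻ˢ⁻¹ B` at `s < t`; the blocks above the diagonal are the transposes. -/
def toeplitzBlock (A : Matrix n n ℝ) (B : Matrix n m ℝ) (L : Matrix m n ℝ) (W : Matrix m m ℝ)
    (t s : ℕ) : Matrix m m ℝ :=
  if s < t then L * A ^ (t - s - 1) * B
  else if t < s then (L * A ^ (s - t - 1) * B)ᵀ else W

variable {A P F : Matrix n n ℝ} {B : Matrix n m ℝ} {L S K : Matrix m n ℝ} {R W : Matrix m m ℝ}

lemma toeplitzBlock_transpose (hW : Wᵀ = W) (t s : ℕ) :
    (toeplitzBlock A B L W t s)ᵀ = toeplitzBlock A B L W s t := by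
  unfold toeplitzBlock
  rcases lt_trichotomy s t with h | rfl | h
  · rw [if_pos h, if_neg h.not_gt, if_pos h]
  · simp [hW]
  · rw [if_neg h.not_gt, if_pos h, if_pos h, transpose_transpose]

lemma sum_range_split_at {M : Type*} [AddCommMonoid M] (f : ℕ → M) (t r : ℕ) :
    ∑ s ∈ Finset.range (t + 1 + r), f s =
      ∑ s ∈ Finset.range t, f s + f t + ∑ l ∈ Finset.range r, f (t + 1 + l) := by
  rw [Finset.sum_range_add, Finset.sum_range_succ]

/-- The closed loop state `Fᵗ`, `F = A - B K`, is the free evolution `Aᵗ` minus the response to the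
controls `K Fˢ`. -/
lemma pow_sub_mul_eq (A : Matrix n n ℝ) (B : Matrix n m ℝ) (K : Matrix m n ℝ) (t : ℕ) :
    ∑ s ∈ Finset.range t, A ^ (t - s - 1) * B * (K * (A - B * K) ^ s) =
      A ^ t - (A - B * K) ^ t := by
  induction t with
  | zero => simp
  | succ t ih =>
    rw [Finset.sum_range_succ]
    have h1 : ∑ s ∈ Finset.range t, A ^ (t + 1 - s - 1) * B * (K * (A - B * K) ^ s) =
        A * ∑ s ∈ Finset.range t, A ^ (t - s - 1) * B * (K * (A - B * K) ^ s) := by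
      rw [Finset.mul_sum]
      refine Finset.sum_congr rfl fun s hs => ?_
      have : t + 1 - s - 1 = (t - s - 1) + 1 := by
        have := Finset.mem_range.1 hs
        omega
      rw [this, pow_succ']
      simp only [Matrix.mul_assoc]
    have h2 : t + 1 - t - 1 = 0 := by omega
    rw [h1, ih, h2, pow_zero, Matrix.one_mul, pow_succ' A, pow_succ' (A - B * K), Matrix.sub_mul,
      Matrix.mul_sub, Matrix.mul_assoc B]
    abel

/-- First order optimality of the closed loop controls `K Fˢ`, `F = A - B K`, restricted to a
horizon `T`. The last term is the contribution of the controls after time `T`. -/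
lemma sum_toeplitzBlock_mul_gain {Δ : Matrix n n ℝ}
    (hΔ : Δ = -(Lᵀ * K) + Aᵀ * Δ * (A - B * K)) (hWK : W * K = L + Bᵀ * Δ * (A - B * K))
    {t T : ℕ} (ht : t < T) :
    ∑ s ∈ Finset.range T, toeplitzBlock A B L W t s * (K * (A - B * K) ^ s) =
      L * A ^ t + Bᵀ * (Aᵀ ^ (T - 1 - t) * Δ * (A - B * K) ^ T) := by
  obtain ⟨r, rfl⟩ := Nat.exists_eq_add_of_lt ht
  have hr : t + r + 1 - 1 - t = r := by omega
  have hT : t + r + 1 = t + 1 + r := by omega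
  rw [hr, hT, sum_range_split_at]
  have h1 : ∑ s ∈ Finset.range t, toeplitzBlock A B L W t s * (K * (A - B * K) ^ s) =
      L * A ^ t - L * (A - B * K) ^ t := by
    rw [← Matrix.mul_sub, ← pow_sub_mul_eq, Matrix.mul_sum]
    refine Finset.sum_congr rfl fun s hs => ?_
    rw [toeplitzBlock, if_pos (Finset.mem_range.1 hs)]
    simp only [Matrix.mul_assoc]
  have h2 : toeplitzBlock A B L W t t * (K * (A - B * K) ^ t) =
      L * (A - B * K) ^ t + Bᵀ * Δ * (A - B * K) ^ (t + 1) := by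
    rw [toeplitzBlock, if_neg (lt_irrefl t), if_neg (lt_irrefl t), ← Matrix.mul_assoc, hWK,
      Matrix.add_mul, pow_succ', Matrix.mul_assoc (Bᵀ * Δ)]
  have h3 : ∑ l ∈ Finset.range r, toeplitzBlock A B L W t (t + 1 + l) *
      (K * (A - B * K) ^ (t + 1 + l)) =
      Bᵀ * (Aᵀ ^ r * Δ * (A - B * K) ^ (t + 1 + r)) - Bᵀ * Δ * (A - B * K) ^ (t + 1) := by
    have h4 := stein_iterate hΔ r
    have h5 : ∑ l ∈ Finset.range r, Aᵀ ^ l * (Lᵀ * K) * (A - B * K) ^ l =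
        Aᵀ ^ r * Δ * (A - B * K) ^ r - Δ := by
      simp only [Matrix.mul_neg, Matrix.neg_mul, Finset.sum_neg_distrib] at h4
      rw [eq_sub_iff_add_eq]
      conv_lhs =>
        arg 2
        rw [h4]
      abel
    have h6 : Bᵀ * (Aᵀ ^ r * Δ * (A - B * K) ^ (t + 1 + r)) - Bᵀ * Δ * (A - B * K) ^ (t + 1) =
        Bᵀ * (Aᵀ ^ r * Δ * (A - B * K) ^ r - Δ) * (A - B * K) ^ (t + 1) := by
      rw [add_comm (t + 1) r, pow_add]
      simp only [Matrix.mul_sub, Matrix.sub_mul, Matrix.mul_assoc]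
    rw [h6, ← h5, Matrix.mul_sum, Matrix.sum_mul]
    refine Finset.sum_congr rfl fun l _ => ?_
    have h7 : t + 1 + l - t - 1 = l := by omega
    rw [toeplitzBlock, if_neg (by omega), if_pos (by omega), h7, add_comm (t + 1) l, pow_add]
    simp only [transpose_mul, transpose_pow, Matrix.mul_assoc]
  rw [h1, h2, h3]
  abel

/-- The state driven by the controls `v` from the initial state zero, without noise. -/
def forcedState (A : Matrix n n ℝ) (B : Matrix n m ℝ) (v : ℕ → m → ℝ) : ℕ → n → ℝ
  | 0 => 0
  | t + 1 => A *ᵥ forcedState A B v t + B *ᵥ v t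

lemma forcedState_eq_sum (A : Matrix n n ℝ) (B : Matrix n m ℝ) (v : ℕ → m → ℝ) (t : ℕ) :
    forcedState A B v t = ∑ s ∈ Finset.range t, (A ^ (t - s - 1) * B) *ᵥ v s := by
  induction t with
  | zero => simp [forcedState]
  | succ t ih =>
    have h2 : t + 1 - t - 1 = 0 := by omega
    rw [forcedState, ih, Finset.sum_range_succ, h2, pow_zero, Matrix.one_mul, mulVec_sum]
    congr 1
    refine Finset.sum_congr rfl fun s hs => ?_
    have : t + 1 - s - 1 = (t - s - 1) + 1 := by
      have := Finset.mem_range.1 hs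
      omega
    rw [this, pow_succ', mulVec_mulVec, Matrix.mul_assoc]

/-- The Toeplitz form is the cost from the zero state, with the cost of the uncontrolled evolution
(`P = Q + AᵀPA`) as terminal cost. -/
lemma toeplitz_form_eq_cost {Q : Matrix n n ℝ} (hP : P = Q + Aᵀ * P * A) (hPt : Pᵀ = P)
    (hR : Rᵀ = R) (v : ℕ → m → ℝ) (T : ℕ) :
    ∑ t ∈ Finset.range T, ∑ s ∈ Finset.range T,
        v t ⬝ᵥ toeplitzBlock A B (Bᵀ * P * A + S) (R + Bᵀ * P * B) t s *ᵥ v s =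
      ∑ t ∈ Finset.range T, stageCost Q R S (forcedState A B v t) (v t) +
        forcedState A B v T ⬝ᵥ P *ᵥ forcedState A B v T := by
  induction T with
  | zero => simp [forcedState]
  | succ T ih =>
    set L := Bᵀ * P * A + S with hL
    set W := R + Bᵀ * P * B with hW
    have hWt : Wᵀ = W := by
      simp only [hW, transpose_add, transpose_mul, transpose_transpose, hPt, hR, Matrix.mul_assoc]
    set x := forcedState A B v T with hx
    have hsw : ∀ t s, v t ⬝ᵥ toeplitzBlock A B L W t s *ᵥ v s =
        v s ⬝ᵥ toeplitzBlock A B L W s t *ᵥ v t := by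
      intro t s
      rw [← toeplitzBlock_transpose hWt s t, mulVec_transpose, dotProduct_comm,
        ← dotProduct_mulVec]
    have hrow : ∑ s ∈ Finset.range T, v T ⬝ᵥ toeplitzBlock A B L W T s *ᵥ v s =
        v T ⬝ᵥ L *ᵥ x := by
      rw [hx, forcedState_eq_sum, mulVec_sum, dotProduct_sum]
      refine Finset.sum_congr rfl fun s hs => ?_
      rw [toeplitzBlock, if_pos (Finset.mem_range.1 hs), mulVec_mulVec, Matrix.mul_assoc]
    have hdiag : toeplitzBlock A B L W T T = W := by simp [toeplitzBlock]
    have e1 : ∑ t ∈ Finset.range (T + 1), ∑ s ∈ Finset.range (T + 1),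
        v t ⬝ᵥ toeplitzBlock A B L W t s *ᵥ v s =
        ∑ t ∈ Finset.range T, ∑ s ∈ Finset.range T, v t ⬝ᵥ toeplitzBlock A B L W t s *ᵥ v s +
          2 * (v T ⬝ᵥ L *ᵥ x) + v T ⬝ᵥ W *ᵥ v T := by
      simp only [Finset.sum_range_succ, Finset.sum_add_distrib, hsw _ T, hrow, hdiag]
      ring
    have hxP : x ⬝ᵥ P *ᵥ x = x ⬝ᵥ Q *ᵥ x + (A *ᵥ x) ⬝ᵥ P *ᵥ (A *ᵥ x) := by
      conv_lhs => rw [hP]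
      rw [add_mulVec, dotProduct_add, ← mulVec_mulVec, ← mulVec_mulVec, dotProduct_mulVec x Aᵀ,
        vecMul_transpose]
    have hcross : (A *ᵥ x) ⬝ᵥ P *ᵥ (B *ᵥ v T) = v T ⬝ᵥ (Bᵀ * P * A) *ᵥ x := by
      rw [dotProduct_mulVec, ← mulVec_transpose, hPt, dotProduct_comm, ← mulVec_mulVec,
        ← mulVec_mulVec, dotProduct_mulVec (v T), vecMul_transpose]
    have hcross' : (B *ᵥ v T) ⬝ᵥ P *ᵥ (A *ᵥ x) = v T ⬝ᵥ (Bᵀ * P * A) *ᵥ x := by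
      rw [← mulVec_mulVec, ← mulVec_mulVec, dotProduct_mulVec (v T), vecMul_transpose]
    have hBB : (B *ᵥ v T) ⬝ᵥ P *ᵥ (B *ᵥ v T) = v T ⬝ᵥ (Bᵀ * P * B) *ᵥ v T := by
      rw [← mulVec_mulVec, ← mulVec_mulVec, dotProduct_mulVec (v T) Bᵀ, vecMul_transpose]
    rw [e1, ih, Finset.sum_range_succ, forcedState, ← hx, stageCost, hxP]
    simp only [mulVec_add, add_dotProduct, dotProduct_add, hcross, hcross', hBB, hL, hW, add_mulVec]
    ring

lemma le_toeplitz_form {Q : Matrix n n ℝ} (hQ : Q.PosDef) (hRS : (R - S * Q⁻¹ * Sᵀ).PosDef)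
    (hP : P = Q + Aᵀ * P * A) (hPs : P.PosSemidef) (v : ℕ → m → ℝ) (T : ℕ) :
    lambdaMin (R - S * Q⁻¹ * Sᵀ) * ∑ t ∈ Finset.range T, v t ⬝ᵥ v t ≤
    ∑ t ∈ Finset.range T, ∑ s ∈ Finset.range T,
        v t ⬝ᵥ toeplitzBlock A B (Bᵀ * P * A + S) (R + Bᵀ * P * B) t s *ᵥ v s := by
  rw [toeplitz_form_eq_cost hP hPs.isHermitian (transpose_eq_of_posDef_schur hQ hRS),
    Finset.mul_sum]
  have h1 := hPs.dotProduct_mulVec_nonneg (forcedState A B v T)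
  rw [star_trivial] at h1
  have h2 := Finset.sum_le_sum fun t (_ : t ∈ Finset.range T) =>
    lambdaMin_schur_le_stageCost hQ hRS (forcedState A B v t) (v t)
  linarith

lemma dotProduct_mulVec_le_norm (X : Matrix m m ℝ) (u v : EuclideanSpace ℝ m) :
    u.ofLp ⬝ᵥ X *ᵥ v.ofLp ≤ ‖X‖ * (‖u‖ * ‖v‖) := by
  have h := (real_inner_le_norm u (toEuclideanLin X v)).trans
    (mul_le_mul_of_nonneg_left (norm_toEuclideanLin_le X v) (norm_nonneg u))
  rw [EuclideanSpace.inner_eq_star_dotProduct, star_trivial, dotProduct_comm] at h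
  refine h.trans (le_of_eq ?_)
  ring

/-- Schur test for a symmetric kernel `h` dominating the blocks. -/
lemma block_form_le_of_row_sums {X : ℕ → ℕ → Matrix m m ℝ} {h : ℕ → ℕ → ℝ} {C : ℝ} {T : ℕ}
    (hX : ∀ t s, ‖X t s‖ ≤ h t s) (hsymm : ∀ t s, h t s = h s t)
    (hrow : ∀ t < T, ∑ s ∈ Finset.range T, h t s ≤ C) (v : ℕ → EuclideanSpace ℝ m) :
    ∑ t ∈ Finset.range T, ∑ s ∈ Finset.range T, (v t).ofLp ⬝ᵥ X t s *ᵥ (v s).ofLp ≤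
      C * ∑ t ∈ Finset.range T, ‖v t‖ ^ 2 := by
  have h0 : ∀ t s, 0 ≤ h t s := fun t s => (norm_nonneg _).trans (hX t s)
  have h1 : ∀ t s, (v t).ofLp ⬝ᵥ X t s *ᵥ (v s).ofLp ≤
      h t s * ‖v t‖ ^ 2 / 2 + h s t * ‖v s‖ ^ 2 / 2 := by
    intro t s
    rw [hsymm s t]
    have h2 := (dotProduct_mulVec_le_norm (X t s) (v t) (v s)).trans
      (mul_le_mul_of_nonneg_right (hX t s) (by positivity))
    nlinarith [mul_nonneg (h0 t s) (sq_nonneg (‖v t‖ - ‖v s‖))]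
  have h2 : ∑ t ∈ Finset.range T, ∑ s ∈ Finset.range T, h t s * ‖v t‖ ^ 2 / 2 ≤
      C * (∑ t ∈ Finset.range T, ‖v t‖ ^ 2) / 2 := by
    rw [Finset.mul_sum, Finset.sum_div]
    refine Finset.sum_le_sum fun t ht => ?_
    rw [← Finset.sum_div, ← Finset.sum_mul]
    have := mul_le_mul_of_nonneg_right (hrow t (Finset.mem_range.1 ht)) (sq_nonneg ‖v t‖)
    linarith
  have h3 := Finset.sum_le_sum fun t (_ : t ∈ Finset.range T) =>
    Finset.sum_le_sum fun s (_ : s ∈ Finset.range T) => h1 t s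
  simp only [Finset.sum_add_distrib] at h3
  rw [Finset.sum_comm (f := fun t s => h s t * ‖v s‖ ^ 2 / 2)] at h3
  linarith

/-- Row sums of a scalar Toeplitz kernel with diagonal `α` and geometric off-diagonal part. -/
lemma row_sum_geometric_le {α β x : ℝ} (hβ : 0 ≤ β) (hx0 : 0 ≤ x) (hx : x < 1) {t T : ℕ}
    (ht : t < T) :
    ∑ s ∈ Finset.range T, (if s < t then β * x ^ (t - s - 1) else if t < s then
      β * x ^ (s - t - 1) else α) ≤ α + 2 * (β / (1 - x)) := by
  obtain ⟨r, rfl⟩ := Nat.exists_eq_add_of_lt ht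
  have hT : t + r + 1 = t + 1 + r := by omega
  have hg : ∀ k, ∑ l ∈ Finset.range k, β * x ^ l ≤ β / (1 - x) := fun k => by
    rw [← Finset.mul_sum, div_eq_mul_inv, ← tsum_geometric_of_lt_one hx0 hx]
    exact mul_le_mul_of_nonneg_left ((summable_geometric_of_lt_one hx0 hx).sum_le_tsum _
      fun j _ => pow_nonneg hx0 j) hβ
  rw [hT, sum_range_split_at]
  have h1 : ∑ s ∈ Finset.range t, (if s < t then β * x ^ (t - s - 1) else if t < s then
      β * x ^ (s - t - 1) else α) = ∑ l ∈ Finset.range t, β * x ^ l := by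
    rw [← Finset.sum_range_reflect]
    refine Finset.sum_congr rfl fun s hs => ?_
    have := Finset.mem_range.1 hs
    rw [if_pos (by omega)]
    congr 2
    omega
  have h2 : ∑ l ∈ Finset.range r, (if t + 1 + l < t then β * x ^ (t - (t + 1 + l) - 1) else
      if t < t + 1 + l then β * x ^ (t + 1 + l - t - 1) else α) =
      ∑ l ∈ Finset.range r, β * x ^ l := by
    refine Finset.sum_congr rfl fun l _ => ?_
    rw [if_neg (by omega), if_pos (by omega)]
    congr 2
    omega
  rw [h1, h2, if_neg (lt_irrefl t), if_neg (lt_irrefl t)]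
  linarith [hg t, hg r]

/-- The diagonal part `R` is bounded by its largest eigenvalue, the rest by the Schur test with a
geometric kernel. -/
lemma toeplitz_form_le {Q : Matrix n n ℝ} {τ ρ : ℝ} (hτ : 1 ≤ τ) (hρ : 0 < ρ)
    (hA : IsExpStable A τ ρ) (hR : Rᵀ = R) (hP : P = Q + Aᵀ * P * A)
    (v : ℕ → EuclideanSpace ℝ m) (T : ℕ) :
    ∑ t ∈ Finset.range T, ∑ s ∈ Finset.range T,
      (v t).ofLp ⬝ᵥ toeplitzBlock A B (Bᵀ * P * A + S) (R + Bᵀ * P * B) t s *ᵥ (v s).ofLp ≤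
    (lambdaMax R + 4 * τ ^ 2 * (‖B‖ ^ 2 * ‖Q‖ + ‖B‖ * ‖S‖) / (1 - Real.exp (-2 * ρ)) ^ 2) *
      ∑ t ∈ Finset.range T, ‖v t‖ ^ 2 := by
  set x := Real.exp (-ρ) with hx
  have hx0 : 0 < x := Real.exp_pos _
  have hx1 : x < 1 := Real.exp_lt_one_iff.2 (by linarith)
  have hx2 : Real.exp (-2 * ρ) = x ^ 2 := by
    rw [hx, ← Real.exp_nat_mul]
    congr 1
    push_cast
    ring
  have hxk : ∀ k : ℕ, Real.exp (-ρ * k) = x ^ k := fun k => by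
    rw [hx, ← Real.exp_nat_mul, mul_comm]
  have hy : 0 < 1 - x ^ 2 := by nlinarith
  set α := ‖B‖ ^ 2 * (τ ^ 2 * ‖Q‖ / (1 - x ^ 2)) with hα
  set σ := ‖S‖ * ‖B‖ * τ with hσ
  have hα0 : 0 ≤ α := by positivity
  have hσ0 : 0 ≤ σ := by positivity
  have hPA : ∀ k : ℕ, ‖P * A ^ k‖ ≤ τ ^ 2 * ‖Q‖ / (1 - x ^ 2) * x ^ k := fun k => by
    have := norm_pow_mul_stein_mul_pow_le hρ hA.transpose hA hP 0 k
    rwa [pow_zero, Matrix.one_mul, zero_add, hx2, hxk] at this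
  have hoff : ∀ k : ℕ, ‖(Bᵀ * P * A + S) * A ^ k * B‖ ≤ (α * x + σ) * x ^ k := by
    intro k
    have e : (Bᵀ * P * A + S) * A ^ k * B = Bᵀ * (P * A ^ (k + 1)) * B + S * A ^ k * B := by
      rw [pow_succ']
      simp only [Matrix.add_mul, Matrix.mul_assoc]
    have h1 : ‖Bᵀ * (P * A ^ (k + 1)) * B‖ ≤
        ‖B‖ * (τ ^ 2 * ‖Q‖ / (1 - x ^ 2) * x ^ (k + 1)) * ‖B‖ := by
      refine (l2_opNorm_mul _ _).trans ?_
      gcongr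
      refine (l2_opNorm_mul _ _).trans ?_
      rw [norm_transpose_eq]
      gcongr
      exact hPA _
    have h2 : ‖S * A ^ k * B‖ ≤ ‖S‖ * (τ * x ^ k) * ‖B‖ := by
      refine (l2_opNorm_mul _ _).trans ?_
      gcongr
      refine (l2_opNorm_mul _ _).trans ?_
      gcongr
      rw [← hxk]
      exact hA k
    rw [e]
    refine (norm_add_le _ _).trans ((add_le_add h1 h2).trans (le_of_eq ?_))
    rw [hα, hσ]
    ring
  set X : ℕ → ℕ → Matrix m m ℝ := fun t s =>
    toeplitzBlock A B (Bᵀ * P * A + S) (Bᵀ * P * B) t s with hXdef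
  have hX : ∀ t s, ‖X t s‖ ≤ (if s < t then (α * x + σ) * x ^ (t - s - 1) else if t < s then
      (α * x + σ) * x ^ (s - t - 1) else α) := by
    intro t s
    simp only [hXdef, toeplitzBlock]
    split_ifs
    · exact hoff _
    · rw [norm_transpose_eq]
      exact hoff _
    · refine (l2_opNorm_mul _ _).trans ?_
      have h1 := (l2_opNorm_mul Bᵀ P).trans (mul_le_mul_of_nonneg_left
        (by simpa using hPA 0) (norm_nonneg _))
      rw [norm_transpose_eq] at h1
      refine (mul_le_mul_of_nonneg_right h1 (norm_nonneg _)).trans (le_of_eq ?_)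
      rw [hα]
      ring
  have hsymm : ∀ t s : ℕ, (if s < t then (α * x + σ) * x ^ (t - s - 1) else if t < s then
      (α * x + σ) * x ^ (s - t - 1) else α) = (if t < s then (α * x + σ) * x ^ (s - t - 1) else
      if s < t then (α * x + σ) * x ^ (t - s - 1) else α) := by
    intro t s
    split_ifs <;> first | rfl | omega
  have hmain := block_form_le_of_row_sums (T := T) hX hsymm
    (fun t ht => row_sum_geometric_le (by positivity) hx0.le hx1 ht) v
  have hC : α + 2 * ((α * x + σ) / (1 - x)) ≤
      4 * τ ^ 2 * (‖B‖ ^ 2 * ‖Q‖ + ‖B‖ * ‖S‖) / (1 - Real.exp (-2 * ρ)) ^ 2 := by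
    have h1x : 0 < 1 - x := by linarith
    have e1 : α + 2 * ((α * x + σ) / (1 - x)) =
        (α * (1 + x) ^ 2 + 2 * σ * (1 + x)) / (1 - x ^ 2) := by
      have : 1 - x ^ 2 = (1 - x) * (1 + x) := by ring
      rw [this]
      field_simp
      ring
    have e2 : 4 * τ ^ 2 * (‖B‖ ^ 2 * ‖Q‖ + ‖B‖ * ‖S‖) / (1 - x ^ 2) ^ 2 =
        (4 * α + 4 * (τ * σ / (1 - x ^ 2))) / (1 - x ^ 2) := by
      rw [hα, hσ]
      field_simp
    have h3 : σ ≤ τ * σ / (1 - x ^ 2) := by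
      rw [le_div_iff₀ hy]
      nlinarith [mul_nonneg hσ0 (sq_nonneg x)]
    rw [hx2, e1, e2]
    refine div_le_div_of_nonneg_right ?_ hy.le
    nlinarith [mul_nonneg hα0 h1x.le, mul_nonneg hσ0 h1x.le,
      mul_nonneg (mul_nonneg hα0 hx0.le) h1x.le]
  have hsplit : ∀ t s, toeplitzBlock A B (Bᵀ * P * A + S) (R + Bᵀ * P * B) t s =
      (if t = s then R else 0) + X t s := by
    intro t s
    simp only [hXdef, toeplitzBlock]
    rcases lt_trichotomy s t with h | rfl | h
    · rw [if_pos h, if_pos h, if_neg h.ne', zero_add]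
    · simp
    · rw [if_neg h.not_gt, if_pos h, if_neg h.not_gt, if_pos h, if_neg h.ne, zero_add]
  have hRpart : ∀ t ∈ Finset.range T, ∑ s ∈ Finset.range T,
      (v t).ofLp ⬝ᵥ (if t = s then R else 0) *ᵥ (v s).ofLp ≤ lambdaMax R * ‖v t‖ ^ 2 := by
    intro t ht
    rw [Finset.sum_eq_single t, if_pos rfl]
    · refine (dotProduct_le_lambdaMax_mul hR _).trans (le_of_eq ?_)
      rw [EuclideanSpace.real_norm_sq_eq]
      simp [dotProduct, sq]
    · intro s _ hs
      rw [if_neg (Ne.symm hs)]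
      simp
    · exact fun h => absurd ht h
  simp only [hsplit, add_mulVec, dotProduct_add, Finset.sum_add_distrib]
  have h1 := Finset.sum_le_sum hRpart
  rw [← Finset.mul_sum] at h1
  have h2 := mul_le_mul_of_nonneg_right hC
    (Finset.sum_nonneg fun t (_ : t ∈ Finset.range T) => sq_nonneg ‖v t‖)
  rw [add_mul]
  linarith

end Toeplitz

/-! ### Neumann iteration -/

section Neumann

variable {H : Type*} [NormedAddCommGroup H] [InnerProductSpace ℝ H]

/-- A symmetric operator with form between `0` and `θ` has norm at most `θ`. -/
lemma norm_apply_le_of_symmetric_of_form {Y : H →ₗ[ℝ] H} (hY : Y.IsSymmetric) {θ : ℝ} (hθ : 0 ≤ θ)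
    (h0 : ∀ v, 0 ≤ inner ℝ v (Y v)) (h1 : ∀ v, inner ℝ v (Y v) ≤ θ * ‖v‖ ^ 2) (v : H) :
    ‖Y v‖ ≤ θ * ‖v‖ := by
  -- positivity of the form at `Y v + r v`, for suitable `r`
  have key : ∀ r : ℝ, 0 ≤ θ * ‖Y v‖ ^ 2 + 2 * r * ‖Y v‖ ^ 2 + r ^ 2 * (θ * ‖v‖ ^ 2) := by
    intro r
    have h2 := h0 (Y v + r • v)
    have h3 : inner ℝ v (Y (Y v)) = ‖Y v‖ ^ 2 := by
      rw [← hY, real_inner_self_eq_norm_sq]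
    simp only [map_add, map_smul, inner_add_left, inner_add_right, real_inner_smul_left,
      real_inner_smul_right, real_inner_self_eq_norm_sq, h3] at h2
    nlinarith [h1 (Y v), mul_le_mul_of_nonneg_left (h1 v) (sq_nonneg r)]
  rcases hθ.eq_or_lt with rfl | hθ'
  · have := key (-1)
    have h4 : ‖Y v‖ ^ 2 ≤ 0 := by nlinarith
    have h5 : ‖Y v‖ = 0 := pow_eq_zero_iff two_ne_zero |>.1 (le_antisymm h4 (sq_nonneg _))
    simp [h5]
  · have := key (-θ)
    refine (sq_le_sq₀ (norm_nonneg _) (by positivity)).1 ?_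
    have h4 : θ * ‖Y v‖ ^ 2 ≤ θ * (θ * ‖v‖) ^ 2 := by nlinarith
    exact le_of_mul_le_mul_left h4 hθ'

/-- Partial sums `β⁻¹ ∑_{l < k} Yˡ g` of the Neumann series for `M u = g`, `Y = 1 - β⁻¹ M`. -/
noncomputable def neumannSum (M : H →ₗ[ℝ] H) (β : ℝ) (g : H) : ℕ → H
  | 0 => 0
  | k + 1 => β⁻¹ • g + (neumannSum M β g k - β⁻¹ • M (neumannSum M β g k))

/-- Truncated Neumann series, for `M` symmetric with `lam ≤ M ≤ β`, and a solution `u` of the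
perturbed equation `M u = g + e`. -/
lemma norm_sub_neumannSum_le {M : H →ₗ[ℝ] H} (hM : M.IsSymmetric) {lam β : ℝ} (hlam : 0 < lam)
    (hβ : lam ≤ β) (hl : ∀ v, lam * ‖v‖ ^ 2 ≤ inner ℝ v (M v))
    (hu : ∀ v, inner ℝ v (M v) ≤ β * ‖v‖ ^ 2) {u g e : H} (hue : M u = g + e) (k : ℕ) :
    ‖u - neumannSum M β g k‖ ≤ (1 - lam / β) ^ k * (‖g‖ / lam) + ‖e‖ / lam := by
  have hβ0 : 0 < β := hlam.trans_le hβ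
  set θ := 1 - lam / β with hθ
  have hθ0 : 0 ≤ θ := sub_nonneg.2 ((div_le_one hβ0).2 hβ)
  have hY : ∀ v, ‖v - β⁻¹ • M v‖ ≤ θ * ‖v‖ := by
    have hs : (LinearMap.id - β⁻¹ • M : H →ₗ[ℝ] H).IsSymmetric := by
      intro x y
      simp only [LinearMap.sub_apply, LinearMap.smul_apply, LinearMap.id_apply, inner_sub_left,
        inner_sub_right, real_inner_smul_left, real_inner_smul_right, hM x y]
    have h1 : ∀ v, inner ℝ v ((LinearMap.id - β⁻¹ • M : H →ₗ[ℝ] H) v) =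
        ‖v‖ ^ 2 - β⁻¹ * inner ℝ v (M v) := by
      intro v
      simp only [LinearMap.sub_apply, LinearMap.smul_apply, LinearMap.id_apply, inner_sub_right,
        real_inner_smul_right, real_inner_self_eq_norm_sq]
    refine fun v => norm_apply_le_of_symmetric_of_form hs hθ0 (fun v => ?_) (fun v => ?_) v
    · rw [h1, sub_nonneg, inv_mul_le_iff₀ hβ0]
      exact hu v
    · rw [h1, hθ]
      have := mul_le_mul_of_nonneg_left (hl v) (inv_nonneg.2 hβ0.le)
      have e1 : (1 - lam / β) * ‖v‖ ^ 2 = ‖v‖ ^ 2 - β⁻¹ * (lam * ‖v‖ ^ 2) := by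
        rw [div_eq_mul_inv]; ring
      linarith
  have hnorm : lam * ‖u‖ ≤ ‖g‖ + ‖e‖ := by
    rcases eq_or_ne u 0 with rfl | h
    · simp only [norm_zero, mul_zero]
      positivity
    · have h1 := (hl u).trans (real_inner_le_norm u (M u))
      have h2 : lam * ‖u‖ ≤ ‖M u‖ :=
        le_of_mul_le_mul_left (by nlinarith) (norm_pos_iff.2 h)
      rw [hue] at h2
      exact h2.trans (norm_add_le g e)
  have hβlam : β⁻¹ = (1 - θ) / lam := by
    rw [hθ]; field_simp; ring
  induction k with
  | zero =>
    rw [neumannSum, sub_zero, pow_zero, one_mul, ← add_div, le_div_iff₀ hlam, mul_comm]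
    exact hnorm
  | succ k ih =>
    set s := neumannSum M β g k with hs
    have e1 : u - neumannSum M β g (k + 1) =
        ((u - s) - β⁻¹ • M (u - s)) + β⁻¹ • e := by
      rw [neumannSum, ← hs, map_sub, hue]
      module
    rw [e1]
    refine (norm_add_le _ _).trans ?_
    rw [norm_smul, Real.norm_of_nonneg (inv_nonneg.2 hβ0.le)]
    have h1 := (hY (u - s)).trans (mul_le_mul_of_nonneg_left ih hθ0)
    have e2 : θ ^ (k + 1) * (‖g‖ / lam) + ‖e‖ / lam =
        θ * (θ ^ k * (‖g‖ / lam) + ‖e‖ / lam) + β⁻¹ * ‖e‖ := by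
      rw [hβlam]; ring
    linarith

end Neumann

/-! ### Stacked control sequences -/

section Stacked

variable {m : Type*} [Fintype m] [DecidableEq m] {T : ℕ}

/-- The operator on control sequences of length `T` with blocks `X t s`. -/
noncomputable def stackedOp (T : ℕ) (X : ℕ → ℕ → Matrix m m ℝ) :
    PiLp 2 (fun _ : Fin T => EuclideanSpace ℝ m) →ₗ[ℝ]
      PiLp 2 (fun _ : Fin T => EuclideanSpace ℝ m) where
  toFun v := WithLp.toLp 2 fun t => ∑ s : Fin T, toEuclideanLin (X t s) (v s)
  map_add' u v := by
    ext1 t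
    simp [Finset.sum_add_distrib]
  map_smul' c v := by
    ext1 t
    simp [Finset.smul_sum]

lemma stackedOp_apply (X : ℕ → ℕ → Matrix m m ℝ)
    (v : PiLp 2 (fun _ : Fin T => EuclideanSpace ℝ m)) (t : Fin T) :
    stackedOp T X v t = ∑ s : Fin T, toEuclideanLin (X t s) (v s) := rfl

lemma inner_toEuclideanLin_eq (X : Matrix m m ℝ) (u v : EuclideanSpace ℝ m) :
    inner ℝ u (toEuclideanLin X v) = u.ofLp ⬝ᵥ X *ᵥ v.ofLp := by
  rw [EuclideanSpace.inner_eq_star_dotProduct, star_trivial, dotProduct_comm]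
  rfl

lemma stackedOp_isSymmetric {X : ℕ → ℕ → Matrix m m ℝ} (hX : ∀ t s, (X t s)ᵀ = X s t) :
    (stackedOp T X).IsSymmetric := by
  intro u v
  rw [PiLp.inner_apply, PiLp.inner_apply]
  simp only [stackedOp_apply, sum_inner, inner_sum]
  rw [Finset.sum_comm]
  refine Finset.sum_congr rfl fun s _ => Finset.sum_congr rfl fun t _ => ?_
  rw [real_inner_comm, inner_toEuclideanLin_eq, inner_toEuclideanLin_eq, ← hX s t,
    mulVec_transpose, dotProduct_comm, ← dotProduct_mulVec]

/-- A sequence of length `T`, extended by zero. -/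
noncomputable def extendZero (v : PiLp 2 (fun _ : Fin T => EuclideanSpace ℝ m)) (t : ℕ) :
    EuclideanSpace ℝ m :=
  if h : t < T then v ⟨t, h⟩ else 0

lemma extendZero_coe (v : PiLp 2 (fun _ : Fin T => EuclideanSpace ℝ m)) (t : Fin T) :
    extendZero v t = v t := by
  simp [extendZero]

lemma inner_stackedOp (X : ℕ → ℕ → Matrix m m ℝ)
    (v : PiLp 2 (fun _ : Fin T => EuclideanSpace ℝ m)) :
    inner ℝ v (stackedOp T X v) = ∑ t ∈ Finset.range T, ∑ s ∈ Finset.range T,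
      (extendZero v t).ofLp ⬝ᵥ X t s *ᵥ (extendZero v s).ofLp := by
  rw [PiLp.inner_apply]
  simp only [stackedOp_apply, inner_sum, inner_toEuclideanLin_eq,
    Finset.sum_range, extendZero_coe]

lemma norm_sq_eq_sum_extendZero (v : PiLp 2 (fun _ : Fin T => EuclideanSpace ℝ m)) :
    ‖v‖ ^ 2 = ∑ t ∈ Finset.range T, ‖extendZero v t‖ ^ 2 := by
  rw [PiLp.norm_sq_eq_of_L2, Finset.sum_range]
  simp only [extendZero_coe]

lemma norm_toLp_le_of_geometric {v : Fin T → EuclideanSpace ℝ m} {C x : ℝ} (hC : 0 ≤ C)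
    (hx0 : 0 ≤ x) (hx : x < 1) (hv : ∀ t : Fin T, ‖v t‖ ≤ C * x ^ (t : ℕ)) :
    ‖(WithLp.toLp 2 v : PiLp 2 (fun _ : Fin T => EuclideanSpace ℝ m))‖ ≤
      C / Real.sqrt (1 - x ^ 2) := by
  have hy : 0 < 1 - x ^ 2 := by nlinarith
  refine (sq_le_sq₀ (norm_nonneg _) (by positivity)).1 ?_
  rw [PiLp.norm_sq_eq_of_L2, div_pow, Real.sq_sqrt hy.le]
  calc ∑ t : Fin T, ‖v t‖ ^ 2 ≤ ∑ t : Fin T, C ^ 2 * (x ^ 2) ^ (t : ℕ) := by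
        refine Finset.sum_le_sum fun t _ => ?_
        have := pow_le_pow_left₀ (norm_nonneg _) (hv t) 2
        refine this.trans (le_of_eq ?_)
        rw [mul_pow, ← pow_mul, ← pow_mul, mul_comm 2]
    _ = C ^ 2 * ∑ t ∈ Finset.range T, (x ^ 2) ^ t := by
        rw [← Finset.mul_sum, Finset.sum_range]
    _ ≤ C ^ 2 * (1 - x ^ 2)⁻¹ := by
        have hx2 : x ^ 2 < 1 := by linarith
        rw [← tsum_geometric_of_lt_one (sq_nonneg x) hx2]
        exact mul_le_mul_of_nonneg_left ((summable_geometric_of_lt_one (sq_nonneg x)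
          hx2).sum_le_tsum _ fun j _ => by positivity) (sq_nonneg C)

/-- Reversing time does not change the norm of a control sequence. -/
lemma norm_toLp_rev {v : Fin T → EuclideanSpace ℝ m} :
    ‖(WithLp.toLp 2 (fun t => v (Fin.rev t)) : PiLp 2 (fun _ : Fin T => EuclideanSpace ℝ m))‖ =
      ‖(WithLp.toLp 2 v : PiLp 2 (fun _ : Fin T => EuclideanSpace ℝ m))‖ := by
  refine (sq_eq_sq₀ (norm_nonneg _) (norm_nonneg _)).1 ?_
  rw [PiLp.norm_sq_eq_of_L2, PiLp.norm_sq_eq_of_L2]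
  exact Equiv.sum_comp Fin.revPerm fun t => ‖v t‖ ^ 2

end Stacked

section StackedBlocks

variable {N T : ℕ} {m : Fin N → ℕ} {d : Fin N → Fin N → ℝ}

/-- The iterates of the Neumann series inherit the spatial decay: each application of the operator
costs a factor `1 + ζ` with `ζ = c_M N T`. -/
lemma norm_blockPart_neumannSum_le (hd : IsAgentDistance d)
    {X : ℕ → ℕ → Matrix (BlockIdx m) (BlockIdx m) ℝ}
    {c cJ γ β C : ℝ} (hc : 0 < c) (hcJ : 0 ≤ cJ) (hγ : 0 ≤ γ) (hβ : 1 ≤ β) (hC : 0 ≤ C)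
    (hX : ∀ t s, IsSED d (X t s) c γ) (j : Fin N)
    {g : PiLp 2 (fun _ : Fin T => EuclideanSpace ℝ (BlockIdx m))}
    (hg : ∀ t i, ‖blockPart i (g t)‖ ≤ cJ * Real.exp (-γ * d i j) * C) (hT : 0 < T) (k : ℕ)
    (t : Fin T) (i : Fin N) :
    ‖blockPart i (neumannSum (stackedOp T X) β g k t)‖ ≤
      cJ * ((1 + c * N * T) ^ k / (c * N * T)) * Real.exp (-γ * d i j) * C := by
  have hN : (0 : ℝ) < N := by exact_mod_cast (Fin.pos j)
  have hT' : (0 : ℝ) < T := by exact_mod_cast hT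
  have hβ0 : 0 < β := by linarith
  set ζ := c * N * T with hζ
  have hζ0 : 0 < ζ := by positivity
  -- the exact bound of the geometric sum, with `1 + ζ / β` in place of `1 + ζ`
  have main : ∀ k (t : Fin T) (i : Fin N),
      ‖blockPart i (neumannSum (stackedOp T X) β g k t)‖ ≤
      cJ * (((1 + ζ / β) ^ k - 1) / ζ) * Real.exp (-γ * d i j) * C := by
    intro k
    induction k with
    | zero =>
      intro t i
      simp [neumannSum]
    | succ k ih =>
      intro t i
      set v := neumannSum (stackedOp T X) β g k with hv
      set D := cJ * (((1 + ζ / β) ^ k - 1) / ζ) with hD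
      have hD0 : 0 ≤ D := by
        have h1 : (1 : ℝ) ≤ (1 + ζ / β) ^ k := one_le_pow₀ (by
          have : 0 ≤ ζ / β := by positivity
          linarith)
        exact mul_nonneg hcJ (div_nonneg (by linarith) hζ0.le)
      have e1 : blockPart i (neumannSum (stackedOp T X) β g (k + 1) t) =
          β⁻¹ • blockPart i (g t) + (blockPart i (v t) -
            β⁻¹ • ∑ s : Fin T, ∑ l, toEuclideanLin (blockOf (X t s) i l) (blockPart l (v s))) := by
        have : neumannSum (stackedOp T X) β g (k + 1) t = β⁻¹ • g t + (v t -
            β⁻¹ • ∑ s : Fin T, toEuclideanLin (X t s) (v s)) := rfl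
        rw [this, map_add, map_sub, map_smul, map_smul, map_sum]
        simp only [blockPart_toEuclideanLin]
      have h2 : ‖∑ s : Fin T, ∑ l, toEuclideanLin (blockOf (X t s) i l) (blockPart l (v s))‖ ≤
          ζ * (D * Real.exp (-γ * d i j) * C) := by
        refine (norm_sum_le_of_le (n := fun _ => N * (c * (D * Real.exp (-γ * d i j) * C))) _
          fun s _ => (norm_sum_le_of_le (n := fun _ => c * (D * Real.exp (-γ * d i j) * C)) _
            fun l _ => ?_).trans (le_of_eq ?_)).trans (le_of_eq ?_)
        · calc _ ≤ ‖blockOf (X t s) i l‖ * ‖blockPart l (v s)‖ := norm_toEuclideanLin_le _ _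
            _ ≤ (c * Real.exp (-γ * d i l)) * (D * Real.exp (-γ * d l j) * C) := by
                gcongr
                · exact hX t s i l
                · exact ih s l
            _ = c * (D * Real.exp (-γ * (d i l + d l j)) * C) := by
                rw [mul_add, Real.exp_add]; ring
            _ ≤ _ := by
                have := hd.triangle i j l
                gcongr c * (D * Real.exp ?_ * C)
                nlinarith
        · simp
        · simp [hζ]; ring
      rw [e1]
      refine (norm_add_le _ _).trans ((add_le_add le_rfl (norm_sub_le _ _)).trans ?_)
      rw [norm_smul, norm_smul, Real.norm_of_nonneg (inv_nonneg.2 hβ0.le)]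
      have hb := inv_nonneg.2 hβ0.le
      have e2 : cJ * (((1 + ζ / β) ^ (k + 1) - 1) / ζ) * Real.exp (-γ * d i j) * C =
          β⁻¹ * (cJ * Real.exp (-γ * d i j) * C) + (D * Real.exp (-γ * d i j) * C +
            β⁻¹ * (ζ * (D * Real.exp (-γ * d i j) * C))) := by
        rw [hD, pow_succ]
        generalize (1 + ζ / β) ^ k = p
        field_simp
        ring
      rw [e2]
      gcongr
      · exact hg t i
      · exact ih t i
  refine (main k t i).trans ?_
  have h3 : (1 + ζ / β) ^ k - 1 ≤ (1 + ζ) ^ k := by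
    have h4 : ζ / β ≤ ζ := div_le_self hζ0.le hβ
    have h5 : (1 + ζ / β) ^ k ≤ (1 + ζ) ^ k := pow_le_pow_left₀ (by positivity) (by linarith) k
    linarith
  gcongr

end StackedBlocks

/-! ### Bounds on the data of the Toeplitz equation -/

section Data

variable {n m : Type*} [Fintype n] [DecidableEq n] [Fintype m] [DecidableEq m]
  {A P Q Δ F : Matrix n n ℝ} {B : Matrix n m ℝ} {S K : Matrix m n ℝ} {τ ρ : ℝ}

lemma exp_neg_mul_natCast (ρ : ℝ) (k : ℕ) : Real.exp (-ρ * k) = Real.exp (-ρ) ^ k := by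
  rw [← Real.exp_nat_mul, mul_comm]

lemma exp_neg_two_mul (ρ : ℝ) : Real.exp (-2 * ρ) = Real.exp (-ρ) ^ 2 := by
  rw [← exp_neg_mul_natCast]
  congr 1
  push_cast
  ring

lemma norm_costate_mul_pow_le (hτ : 1 ≤ τ) (hρ : 0 < ρ) (hA : IsExpStable A τ ρ)
    (hP : P = Q + Aᵀ * P * A) (k : ℕ) :
    ‖(Bᵀ * P * A + S) * A ^ k‖ ≤
      τ ^ 2 * (‖B‖ * ‖Q‖ + ‖S‖) / (1 - Real.exp (-2 * ρ)) * Real.exp (-ρ) ^ k := by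
  have hx0 := Real.exp_pos (-ρ)
  have hx1 : Real.exp (-ρ) < 1 := Real.exp_lt_one_iff.2 (by linarith)
  have hw : 0 < 1 - Real.exp (-2 * ρ) := sub_pos.2 (Real.exp_lt_one_iff.2 (by linarith))
  have hw1 : 1 - Real.exp (-2 * ρ) ≤ 1 := by linarith [Real.exp_pos (-2 * ρ)]
  have e : (Bᵀ * P * A + S) * A ^ k = Bᵀ * (P * A ^ (k + 1)) + S * A ^ k := by
    rw [pow_succ']
    simp only [Matrix.add_mul, Matrix.mul_assoc]
  have h0 := norm_pow_mul_stein_mul_pow_le hρ hA.transpose hA hP 0 (k + 1)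
  rw [pow_zero, Matrix.one_mul, zero_add, exp_neg_mul_natCast, pow_succ] at h0
  have h1 : ‖Bᵀ * (P * A ^ (k + 1))‖ ≤
      ‖B‖ * (τ ^ 2 * ‖Q‖ / (1 - Real.exp (-2 * ρ)) * Real.exp (-ρ) ^ k) := by
    refine (l2_opNorm_mul _ _).trans ?_
    rw [norm_transpose_eq]
    gcongr
    exact h0.trans (mul_le_mul_of_nonneg_left
      (mul_le_of_le_one_right (pow_nonneg hx0.le _) hx1.le) (by positivity))
  have h2 : ‖S * A ^ k‖ ≤ ‖S‖ * (τ ^ 2 / (1 - Real.exp (-2 * ρ)) * Real.exp (-ρ) ^ k) := by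
    refine (l2_opNorm_mul _ _).trans ?_
    gcongr
    refine (hA k).trans ?_
    rw [exp_neg_mul_natCast]
    gcongr
    rw [le_div_iff₀ hw]
    nlinarith
  rw [e]
  refine (norm_add_le _ _).trans ((add_le_add h1 h2).trans (le_of_eq ?_))
  ring

/-- The deviation `Δ` between the closed and open loop cost matrices solves a Stein equation;
summing its series with the outer powers inside avoids further factors `τ`. -/
lemma norm_pow_mul_deviation_mul_pow_le (hτ : 1 ≤ τ) (hρ : 0 < ρ) (hA : IsExpStable A τ ρ)
    (hF : IsExpStable F τ ρ) (hP : P = Q + Aᵀ * P * A)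
    (hΔ : Δ = -((Bᵀ * P * A + S)ᵀ * K) + Aᵀ * Δ * F) (k l : ℕ) :
    ‖Aᵀ ^ k * Δ * F ^ l‖ ≤ τ ^ 3 * (‖B‖ * ‖Q‖ + ‖S‖) * ‖K‖ / (1 - Real.exp (-2 * ρ)) ^ 2 *
      (Real.exp (-ρ) ^ l * Real.exp (-ρ) ^ k) := by
  have hx0 := Real.exp_pos (-ρ)
  have hw : 0 < 1 - Real.exp (-2 * ρ) := sub_pos.2 (Real.exp_lt_one_iff.2 (by linarith))
  set L := Bᵀ * P * A + S with hL
  set G := τ ^ 2 * (‖B‖ * ‖Q‖ + ‖S‖) / (1 - Real.exp (-2 * ρ)) with hG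
  have hX : Aᵀ ^ k * Δ * F ^ l = -(Aᵀ ^ k * (Lᵀ * K) * F ^ l) + Aᵀ * (Aᵀ ^ k * Δ * F ^ l) * F := by
    have e : Aᵀ * (Aᵀ ^ k * Δ * F ^ l) * F = Aᵀ ^ k * (Aᵀ * Δ * F) * F ^ l := by
      calc _ = (Aᵀ * Aᵀ ^ k) * Δ * (F ^ l * F) := by noncomm_ring
        _ = (Aᵀ ^ k * Aᵀ) * Δ * (F * F ^ l) := by
          rw [(Commute.self_pow Aᵀ k).eq, (Commute.pow_self F l).eq]
        _ = _ := by noncomm_ring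
    conv_lhs => rw [hΔ]
    rw [e, Matrix.mul_add, Matrix.add_mul, Matrix.mul_neg, Matrix.neg_mul]
  refine (norm_stein_le (C := G * (τ * ‖K‖) * (Real.exp (-ρ) ^ l * Real.exp (-ρ) ^ k))
    (θ := Real.exp (-2 * ρ)) hρ hA.transpose hF hX (by positivity) (Real.exp_pos _).le
    (Real.exp_lt_one_iff.2 (by linarith)) fun j => ?_).trans (le_of_eq ?_)
  · have e : Aᵀ ^ j * -(Aᵀ ^ k * (Lᵀ * K) * F ^ l) * F ^ j =
        -((L * A ^ (j + k))ᵀ * K * F ^ (l + j)) := by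
      rw [transpose_mul, transpose_pow, pow_add, pow_add]
      simp only [Matrix.mul_neg, Matrix.neg_mul, Matrix.mul_assoc]
    rw [e, norm_neg]
    calc ‖(L * A ^ (j + k))ᵀ * K * F ^ (l + j)‖ ≤ ‖L * A ^ (j + k)‖ * ‖K‖ * ‖F ^ (l + j)‖ := by
          refine (l2_opNorm_mul _ _).trans (mul_le_mul_of_nonneg_right ?_ (norm_nonneg _))
          refine (l2_opNorm_mul _ _).trans (le_of_eq ?_)
          rw [norm_transpose_eq]
      _ ≤ (G * Real.exp (-ρ) ^ (j + k)) * ‖K‖ * (τ * Real.exp (-ρ) ^ (l + j)) := by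
          gcongr
          · exact norm_costate_mul_pow_le hτ hρ hA hP _
          · rw [← exp_neg_mul_natCast]
            exact hF _
      _ = _ := by
          rw [exp_neg_two_mul, ← pow_mul, pow_add, pow_add, mul_comm 2 j, pow_mul]
          ring
  · rw [hG]
    field_simp

end Data

section BlockData

variable {N : ℕ} {nx nu : Fin N → ℕ} {d : Fin N → Fin N → ℝ}
  {A P Q : Matrix (BlockIdx nx) (BlockIdx nx) ℝ} {B : Matrix (BlockIdx nx) (BlockIdx nu) ℝ}
  {R : Matrix (BlockIdx nu) (BlockIdx nu) ℝ} {S : Matrix (BlockIdx nu) (BlockIdx nx) ℝ}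
  {γsys a b q r s τ ρ : ℝ}

lemma one_sub_exp_neg_two_mul_pos (hρ : 0 < ρ) : 0 < 1 - Real.exp (-2 * ρ) :=
  sub_pos.2 (Real.exp_lt_one_iff.2 (by linarith))

/-- The right hand side of the Toeplitz equation decays in space. -/
lemma isSED_costate_mul_pow (hd : IsAgentDistance d) (hN : 0 < N) (hγ : 0 < γsys) (ha : 1 ≤ a)
    (hb : 1 ≤ b) (hq : 1 ≤ q) (hs : 0 < s) (hτ : 1 ≤ τ) (hρ : 0 < ρ) (hAd : IsSED d A a γsys)
    (hBd : IsSED d B b γsys) (hQd : IsSED d Q q γsys) (hSd : IsSED d S s γsys)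
    (hA : IsExpStable A τ ρ) (hP : P = Q + Aᵀ * P * A) (k : ℕ) :
    IsSED d ((Bᵀ * P * A + S) * A ^ k) (constJ N b q s τ ρ Q S)
      (γsys * ρ / (ρ + Real.log (a * N))) := by
  have hN1 : (1 : ℝ) ≤ N := by exact_mod_cast hN
  have hlog : 0 ≤ Real.log (a * N) := Real.log_nonneg (one_le_mul_of_one_le_of_one_le ha hN1)
  have hγ' : γsys * ρ / (ρ + Real.log (a * N)) ≤ γsys := by
    rw [div_le_iff₀ (by linarith)]
    nlinarith
  have hw := one_sub_exp_neg_two_mul_pos hρ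
  have e : (Bᵀ * P * A + S) * A ^ k = Bᵀ * (P * A ^ (k + 1)) + S * A ^ k := by
    rw [pow_succ']
    simp only [Matrix.add_mul, Matrix.mul_assoc]
  rw [e]
  have h1 := ((hBd.transpose hd).mono hd le_rfl (by linarith) hγ').mul hd (by linarith)
    (by positivity) (by positivity)
    (IsSED.lyapunov_mul_pow hd (by linarith) ha hγ.le hρ hQd hAd hA hP (k + 1))
  have h2 := IsSED.mul_pow_of_stable hd hs.le ha hγ.le hρ hSd hAd hA k
  have h3 := h1.add h2
  unfold constJ
  convert! h3 using 1
  ring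

lemma isSED_toeplitzBlock (hd : IsAgentDistance d) (hN : 0 < N) (hγ : 0 < γsys) (ha : 1 ≤ a)
    (hb : 1 ≤ b) (hq : 1 ≤ q) (hr : 1 ≤ r) (hs : 0 < s) (hτ : 1 ≤ τ) (hρ : 0 < ρ)
    (hAd : IsSED d A a γsys)
    (hBd : IsSED d B b γsys) (hQd : IsSED d Q q γsys) (hRd : IsSED d R r γsys)
    (hSd : IsSED d S s γsys)
    (hA : IsExpStable A τ ρ) (hP : P = Q + Aᵀ * P * A) (t u : ℕ) :
    IsSED d (toeplitzBlock A B (Bᵀ * P * A + S) (R + Bᵀ * P * B) t u)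
      (constM N b q r s τ ρ Q S) (γsys * ρ / (ρ + Real.log (a * N))) := by
  have hN1 : (1 : ℝ) ≤ N := by exact_mod_cast hN
  have hlog : 0 ≤ Real.log (a * N) := Real.log_nonneg (one_le_mul_of_one_le_of_one_le ha hN1)
  have hγ' : γsys * ρ / (ρ + Real.log (a * N)) ≤ γsys := by
    rw [div_le_iff₀ (by linarith)]
    nlinarith
  have hγ0 : 0 ≤ γsys * ρ / (ρ + Real.log (a * N)) := by positivity
  have hw := one_sub_exp_neg_two_mul_pos hρ
  have hM0 : 0 ≤ constM N b q r s τ ρ Q S := by unfold constM; positivity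
  have hJ0 : 0 ≤ constJ N b q s τ ρ Q S := by unfold constJ; positivity
  have hBd' := hBd.mono hd le_rfl (by linarith) hγ'
  have hoff : ∀ k, IsSED d ((Bᵀ * P * A + S) * A ^ k * B) (constM N b q r s τ ρ Q S)
      (γsys * ρ / (ρ + Real.log (a * N))) := fun k => by
    refine ((isSED_costate_mul_pow hd hN hγ ha hb hq hs hτ hρ hAd hBd hQd hSd hA hP k).mul hd hJ0
      (by linarith) hγ0 hBd').mono hd ?_ hM0 le_rfl
    unfold constJ constM
    nlinarith
  unfold toeplitzBlock
  split_ifs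
  · exact hoff _
  · exact (hoff _).transpose hd
  · have h1 := (((hBd'.transpose hd).mul hd (by linarith) (by positivity) hγ0
      (IsSED.lyapunov_mul_pow hd (by linarith) ha hγ.le hρ hQd hAd hA hP 0)).mul hd (by positivity)
      (by linarith) hγ0 hBd')
    rw [pow_zero, Matrix.mul_one] at h1
    refine ((hRd.mono hd le_rfl (by linarith) hγ').add h1).mono hd ?_ hM0 le_rfl
    unfold constM
    have : 0 ≤ b * N * (s + τ * ‖S‖) := by positivity
    nlinarith

end BlockData

/-! ### Balancing truncation and iteration -/

/-- Rounding the exponent up costs at most one factor `y`. -/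
lemma pow_ceil_le {y κ l : ℝ} (hy : 1 ≤ y) (hyl : y ≤ Real.exp l) (hκ : 0 ≤ κ) :
    y ^ ⌈κ⌉₊ ≤ y * Real.exp (l * κ) := by
  have hl : 0 ≤ l := by
    by_contra h
    have := Real.exp_lt_one_iff.2 (not_le.1 h)
    linarith
  have hE : 1 ≤ Real.exp (l * κ) := Real.one_le_exp (by positivity)
  rcases Nat.eq_zero_or_pos ⌈κ⌉₊ with h | h
  · rw [h, pow_zero]
    nlinarith
  · obtain ⟨k, hk⟩ := Nat.exists_eq_succ_of_ne_zero h.ne'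
    have hkκ : (k : ℝ) ≤ κ := (Nat.lt_ceil.1 (by omega)).le
    rw [hk, pow_succ']
    gcongr
    calc y ^ k ≤ Real.exp l ^ k := pow_le_pow_left₀ (by linarith) hyl k
      _ = Real.exp (k * l) := by rw [← Real.exp_nat_mul]
      _ ≤ _ := Real.exp_le_exp.2 (by nlinarith)

lemma one_sub_div_pow_ceil_le {lam β κ : ℝ} (hlam : 0 ≤ lam) (hβ : lam ≤ β) (hβ0 : 0 < β) :
    (1 - lam / β) ^ ⌈κ⌉₊ ≤ Real.exp (-(lam / β * κ)) := by
  have h0 : 0 ≤ 1 - lam / β := sub_nonneg.2 ((div_le_one hβ0).2 hβ)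
  calc (1 - lam / β) ^ ⌈κ⌉₊ ≤ Real.exp (-(lam / β)) ^ ⌈κ⌉₊ :=
        pow_le_pow_left₀ h0 (by linarith [Real.add_one_le_exp (-(lam / β))]) _
    _ = Real.exp (-(lam / β) * ⌈κ⌉₊) := by rw [← Real.exp_nat_mul, mul_comm]
    _ ≤ _ := Real.exp_le_exp.2 (by
        have := mul_le_mul_of_nonneg_left (Nat.le_ceil κ) (div_nonneg hlam hβ0.le)
        linarith)

/-- With at least two agents the decay rate is so small that a horizon of at most `γsys D + 1`
suffices; `δ` is a distance between two agents. -/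
lemma horizon_le {N : ℕ} {a D γsys ρ lam β l δ : ℝ} (ha : 1 ≤ a) (hγ : 0 < γsys) (hρ : 0 < ρ)
    (hlam : 0 < lam) (hβ : lam ≤ β) (hl : Real.log 2 ≤ l) (hδ0 : 0 ≤ δ) (hδ : δ ≤ D)
    (hN : δ = 0 ∨ 2 ≤ N) :
    ((⌊γsys * ρ * lam / (ρ + Real.log (a * N)) * (1 / (β * l + lam)) * δ / ρ⌋₊ + 1 : ℕ) : ℝ) ≤
      γsys * D + 1 := by
  have hl2 := Real.log_two_gt_d9
  rcases hN with rfl | hN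
  · simp only [mul_zero, zero_div, Nat.floor_zero]
    push_cast
    nlinarith
  have hN' : (2 : ℝ) ≤ N := by exact_mod_cast hN
  have hlog : Real.log 2 ≤ Real.log (a * N) := Real.log_le_log (by norm_num) (by nlinarith)
  have hs : 0 < ρ + Real.log (a * N) := by linarith
  have hden : 0 < β * l + lam := by nlinarith
  have h1 : lam ≤ (ρ + Real.log (a * N)) * (β * l + lam) := by
    have h2 : lam * (1.69 : ℝ) ≤ β * l + lam := by nlinarith
    have h3 : (0.69 : ℝ) ≤ ρ + Real.log (a * N) := by linarith
    nlinarith [mul_le_mul h3 h2 (by positivity) (by linarith)]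
  have h4 : γsys * ρ * lam / (ρ + Real.log (a * N)) * (1 / (β * l + lam)) * δ / ρ ≤ γsys * D := by
    have e : γsys * ρ * lam / (ρ + Real.log (a * N)) * (1 / (β * l + lam)) * δ / ρ =
        γsys * δ * (lam / ((ρ + Real.log (a * N)) * (β * l + lam))) := by
      field_simp
    rw [e]
    have h5 : lam / ((ρ + Real.log (a * N)) * (β * l + lam)) ≤ 1 :=
      (div_le_one (by positivity)).2 h1
    calc _ ≤ γsys * δ * 1 := by gcongr
      _ ≤ γsys * D := by rw [mul_one]; gcongr
  have h6 : 0 ≤ γsys * ρ * lam / (ρ + Real.log (a * N)) * (1 / (β * l + lam)) * δ / ρ := by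
    positivity
  push_cast
  linarith [Nat.floor_le h6]

/-! ### Spatial decay of the gain -/

section Gain

variable {n m : Type*} [Fintype n] [DecidableEq n] [Fintype m] [DecidableEq m]
  {A Q : Matrix n n ℝ} {B : Matrix n m ℝ} {R : Matrix m m ℝ} {S K : Matrix m n ℝ} {τ ρ : ℝ}

lemma lambdaMin_schur_le_lambdaMax [Nonempty m] (hQ : Q.PosDef)
    (hRS : (R - S * Q⁻¹ * Sᵀ).PosDef) : lambdaMin (R - S * Q⁻¹ * Sᵀ) ≤ lambdaMax R := by
  obtain ⟨i⟩ := ‹Nonempty m›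
  have h1 := lambdaMin_schur_le_stageCost hQ hRS 0 (Pi.single i 1)
  have h2 := dotProduct_le_lambdaMax_mul
    (show R.IsHermitian from transpose_eq_of_posDef_schur hQ hRS) (Pi.single i 1)
  simp only [stageCost, mulVec_zero, dotProduct_zero, mul_zero, add_zero, zero_add] at h1
  have h3 : (Pi.single i 1 : m → ℝ) ⬝ᵥ Pi.single i 1 = 1 := by simp
  rw [h3, mul_one] at h1 h2
  exact h1.trans h2

/-- The Riccati equation in terms of the deviation of its solution from the open loop cost
matrix `P`. -/
lemma exists_deviation {P P' : Matrix n n ℝ} (hP : P = Q + Aᵀ * P * A) (hPt : Pᵀ = P)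
    (hP' : P' = Q - Sᵀ * K + Aᵀ * P' * (A - B * K))
    (hRK : R * K = S + Bᵀ * P' * (A - B * K)) :
    ∃ Δ : Matrix n n ℝ, Δ = -((Bᵀ * P * A + S)ᵀ * K) + Aᵀ * Δ * (A - B * K) ∧
      (R + Bᵀ * P * B) * K = (Bᵀ * P * A + S) + Bᵀ * Δ * (A - B * K) := by
  refine ⟨P' - P, ?_, ?_⟩
  · conv_lhs => rw [hP', hP]
    simp only [transpose_add, transpose_mul, transpose_transpose, hPt, Matrix.mul_sub,
      Matrix.sub_mul, Matrix.add_mul, Matrix.mul_assoc]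
    abel
  · rw [Matrix.add_mul, hRK]
    simp only [Matrix.mul_sub, Matrix.sub_mul, Matrix.mul_assoc]
    abel

end Gain

/-- The bound for the truncation error of the Neumann series, compared with its share of `c_K`. -/
lemma far_constant_le {w lam τ b : ℝ} (hw : 0 < w) (hw1 : w ≤ 1) (hlam : 0 < lam) (hb : 0 ≤ b) :
    τ ^ 2 * b / w / √w / lam ≤ 2 * τ ^ 2 * b / (w ^ 2 * lam) := by
  have hsq : 0 < √w := Real.sqrt_pos.2 hw
  have h1 : w ≤ √w := by
    rw [Real.le_sqrt hw.le hw.le, sq]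
    exact mul_le_of_le_one_left hw.le hw1
  have h2 : w ^ 2 * lam ≤ w * (√w * lam) := by
    rw [sq, mul_assoc]
    gcongr
  have h3 : 0 ≤ τ ^ 2 * b := by positivity
  rw [div_div, div_div]
  exact div_le_div₀ (by positivity) (by linarith) (by positivity) h2

/-- The bound for the error of the finite horizon, compared with its share of `c_K`. -/
lemma horizon_constant_le {w lam τ b q s k x y : ℝ} (hw : 0 < w) (hlam : 0 < lam) (hτ : 0 ≤ τ)
    (hb : 0 ≤ b) (hq : 0 ≤ q) (hs : 0 ≤ s) (hk : 0 ≤ k) (hx : 0 ≤ x) (hxy : x ≤ y) :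
    b * (τ ^ 3 * (b * q + s) * k) / w ^ 2 * x / √w / lam ≤
      2 * τ ^ 3 * (b ^ 2 * k * q + b * k * s) / (w ^ (5 / 2 : ℝ) * lam) * y := by
  have hsq : 0 < √w := Real.sqrt_pos.2 hw
  have hpow : w ^ (5 / 2 : ℝ) = w ^ 2 * √w := by
    rw [Real.sqrt_eq_rpow, ← Real.rpow_natCast, ← Real.rpow_add hw]
    norm_num
  have e : b * (τ ^ 3 * (b * q + s) * k) / w ^ 2 * x / √w / lam =
      τ ^ 3 * (b ^ 2 * k * q + b * k * s) / (w ^ 2 * √w * lam) * x := by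
    field_simp
  have h : 0 ≤ τ ^ 3 * (b ^ 2 * k * q + b * k * s) := by positivity
  rw [e, hpow]
  refine mul_le_mul ?_ hxy hx (by positivity)
  exact div_le_div_of_nonneg_right (by linarith) (by positivity)

section GainSED

variable {N : ℕ} {nx nu : Fin N → ℕ} {d : Fin N → Fin N → ℝ}
  {A Q : Matrix (BlockIdx nx) (BlockIdx nx) ℝ} {B : Matrix (BlockIdx nx) (BlockIdx nu) ℝ}
  {R : Matrix (BlockIdx nu) (BlockIdx nu) ℝ} {S K : Matrix (BlockIdx nu) (BlockIdx nx) ℝ}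
  {γsys a b q r s τ ρ D : ℝ}

/-- The decay of the blocks of `K` from the Toeplitz equation over a horizon `T`, solved by `k`
terms of the Neumann series. The three terms are the localized approximation, the truncation error
of the series and the error of the finite horizon. -/
lemma norm_blockOf_gain_le [Nonempty (BlockIdx nu)] (hd : IsAgentDistance d) (hγ : 0 < γsys)
    (ha : 1 ≤ a) (hb : 1 ≤ b) (hq : 1 ≤ q) (hr : 1 ≤ r) (hs : 0 < s)
    (hτ : 1 ≤ τ) (hρ : 0 < ρ) (hQ : Q.PosDef) (hRS : (R - S * Q⁻¹ * Sᵀ).PosDef)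
    (hAd : IsSED d A a γsys) (hBd : IsSED d B b γsys) (hQd : IsSED d Q q γsys)
    (hRd : IsSED d R r γsys) (hSd : IsSED d S s γsys)
    (hA : IsExpStable A τ ρ) (hF : IsExpStable (A - B * K) τ ρ)
    {P' : Matrix (BlockIdx nx) (BlockIdx nx) ℝ}
    (hP' : P' = Q - Sᵀ * K + Aᵀ * P' * (A - B * K))
    (hRK : R * K = S + Bᵀ * P' * (A - B * K)) {β : ℝ} (hβ1 : 1 ≤ β)
    (hβ : lambdaMax R + 4 * τ ^ 2 * (‖B‖ ^ 2 * ‖Q‖ + ‖B‖ * ‖S‖) / (1 - Real.exp (-2 * ρ)) ^ 2 ≤ β)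
    {T : ℕ} (hT : 0 < T) (k : ℕ) (i j : Fin N) :
    ‖blockOf K i j‖ ≤ constJ N b q s τ ρ Q S *
        ((1 + constM N b q r s τ ρ Q S * N * T) ^ k / (constM N b q r s τ ρ Q S * N * T)) *
        Real.exp (-(γsys * ρ / (ρ + Real.log (a * N))) * d i j) +
      (1 - lambdaMin (R - S * Q⁻¹ * Sᵀ) / β) ^ k * (τ ^ 2 * (‖B‖ * ‖Q‖ + ‖S‖) /
        (1 - Real.exp (-2 * ρ)) / √(1 - Real.exp (-2 * ρ)) / lambdaMin (R - S * Q⁻¹ * Sᵀ)) +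
      ‖B‖ * (τ ^ 3 * (‖B‖ * ‖Q‖ + ‖S‖) * ‖K‖) / (1 - Real.exp (-2 * ρ)) ^ 2 *
        Real.exp (-ρ * T) / √(1 - Real.exp (-2 * ρ)) / lambdaMin (R - S * Q⁻¹ * Sᵀ) := by
  have hN : 0 < N := Fin.pos i
  have hN1 : (1 : ℝ) ≤ N := by exact_mod_cast hN
  have hlog : 0 ≤ Real.log (a * N) := Real.log_nonneg (one_le_mul_of_one_le_of_one_le ha hN1)
  have hγ0 : 0 ≤ γsys * ρ / (ρ + Real.log (a * N)) := by positivity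
  have hw := one_sub_exp_neg_two_mul_pos hρ
  have hx1 : Real.exp (-ρ) < 1 := Real.exp_lt_one_iff.2 (by linarith)
  have hM0 : 0 < constM N b q r s τ ρ Q S := by unfold constM; positivity
  have hJ0 : 0 ≤ constJ N b q s τ ρ Q S := by unfold constJ; positivity
  have hRt := transpose_eq_of_posDef_schur hQ hRS
  obtain ⟨P, hP⟩ := exists_stein hρ hA.transpose hA Q
  have hPs := posSemidef_of_lyapunov hρ hA hQ.posSemidef hP
  have hPt : Pᵀ = P := hPs.isHermitian
  obtain ⟨Δ, hΔ, hWK⟩ := exists_deviation hP hPt hP' hRK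
  have hWt : (R + Bᵀ * P * B)ᵀ = R + Bᵀ * P * B := by
    simp only [transpose_add, transpose_mul, transpose_transpose, hPt, hRt, Matrix.mul_assoc]
  have hlam := lambdaMin_pos_of_posDef hRS
  set lam := lambdaMin (R - S * Q⁻¹ * Sᵀ) with hlamdef
  have hlamβ : lam ≤ β := by
    have h1 := lambdaMin_schur_le_lambdaMax hQ hRS
    have h2 : 0 ≤ 4 * τ ^ 2 * (‖B‖ ^ 2 * ‖Q‖ + ‖B‖ * ‖S‖) / (1 - Real.exp (-2 * ρ)) ^ 2 := by
      positivity
    linarith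
  set M := stackedOp T (toeplitzBlock A B (Bᵀ * P * A + S) (R + Bᵀ * P * B)) with hM
  have hMs : M.IsSymmetric := stackedOp_isSymmetric (toeplitzBlock_transpose hWt)
  have hMl : ∀ v, lam * ‖v‖ ^ 2 ≤ inner ℝ v (M v) := by
    intro v
    rw [hM, inner_stackedOp, norm_sq_eq_sum_extendZero]
    have := le_toeplitz_form (B := B) hQ hRS hP hPs (fun t => (extendZero v t).ofLp) T
    refine le_trans (le_of_eq ?_) this
    congr 1
    refine Finset.sum_congr rfl fun t _ => ?_
    rw [EuclideanSpace.real_norm_sq_eq]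
    simp [dotProduct, sq]
  have hMu : ∀ v, inner ℝ v (M v) ≤ β * ‖v‖ ^ 2 := by
    intro v
    rw [hM, inner_stackedOp]
    refine (toeplitz_form_le (B := B) (S := S) hτ hρ hA hRt hP (extendZero v) T).trans ?_
    rw [← norm_sq_eq_sum_extendZero]
    exact mul_le_mul_of_nonneg_right hβ (sq_nonneg _)
  refine norm_le_of_forall_toEuclideanLin ?_ fun y => ?_
  · have h1 : 0 ≤ 1 - lam / β := sub_nonneg.2 ((div_le_one (by linarith)).2 hlamβ)
    positivity
  -- the closed loop controls from an initial state supported at agent `j`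
  set x₀ : EuclideanSpace ℝ (BlockIdx nx) := blockSingle j y with hx₀
  have hx₀n : ‖x₀‖ = ‖y‖ := norm_blockSingle j y
  let E := PiLp 2 (fun _ : Fin T => EuclideanSpace ℝ (BlockIdx nu))
  let u : E := WithLp.toLp 2 fun t => toEuclideanLin (K * (A - B * K) ^ (t : ℕ)) x₀
  let g : E := WithLp.toLp 2 fun t => toEuclideanLin ((Bᵀ * P * A + S) * A ^ (t : ℕ)) x₀
  let e : E := WithLp.toLp 2 fun t =>
    toEuclideanLin (Bᵀ * (Aᵀ ^ (T - 1 - (t : ℕ)) * Δ * (A - B * K) ^ T)) x₀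
  have hue : M u = g + e := by
    ext1 t
    have h1 := sum_toeplitzBlock_mul_gain hΔ hWK t.isLt
    rw [Finset.sum_range] at h1
    have h2 := congrArg (fun Z => toEuclideanLin Z x₀) h1
    simp only [map_sum, map_add, LinearMap.sum_apply, LinearMap.add_apply] at h2
    refine Eq.trans ?_ h2
    rw [hM, stackedOp_apply]
    refine Finset.sum_congr rfl fun s _ => ?_
    simp only [u, toLpLin_apply, mulVec_mulVec]
  have hgb : ∀ t i, ‖blockPart i (g t)‖ ≤ constJ N b q s τ ρ Q S *
      Real.exp (-(γsys * ρ / (ρ + Real.log (a * N))) * d i j) * ‖y‖ := by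
    intro t i
    have h1 : blockPart i (g t) =
        toEuclideanLin (blockOf ((Bᵀ * P * A + S) * A ^ (t : ℕ)) i j) y :=
      (toEuclideanLin_blockOf _ i j y).symm
    rw [h1]
    exact (norm_toEuclideanLin_le _ _).trans (mul_le_mul_of_nonneg_right
      (isSED_costate_mul_pow hd hN hγ ha hb hq hs hτ hρ hAd hBd hQd hSd hA hP t i j)
      (norm_nonneg _))
  have hgn : ‖g‖ ≤ τ ^ 2 * (‖B‖ * ‖Q‖ + ‖S‖) / (1 - Real.exp (-2 * ρ)) * ‖y‖ /
      √(1 - Real.exp (-2 * ρ)) := by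
    rw [exp_neg_two_mul ρ]
    refine norm_toLp_le_of_geometric ?_ (Real.exp_pos _).le hx1 fun t => ?_
    · rw [← exp_neg_two_mul]
      positivity
    · refine (norm_toEuclideanLin_le _ _).trans ((mul_le_mul_of_nonneg_right
        (norm_costate_mul_pow_le hτ hρ hA hP t) (norm_nonneg _)).trans (le_of_eq ?_))
      rw [hx₀n, exp_neg_two_mul]
      ring
  have hen : ‖e‖ ≤ ‖B‖ * (τ ^ 3 * (‖B‖ * ‖Q‖ + ‖S‖) * ‖K‖) / (1 - Real.exp (-2 * ρ)) ^ 2 *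
        Real.exp (-ρ * T) * ‖y‖ / √(1 - Real.exp (-2 * ρ)) := by
    have e1 : ‖e‖ = ‖(WithLp.toLp 2 fun t : Fin T => toEuclideanLin
        (Bᵀ * (Aᵀ ^ (t : ℕ) * Δ * (A - B * K) ^ T)) x₀ : E)‖ := by
      rw [← norm_toLp_rev]
      congr 3
      funext t
      have : T - 1 - (Fin.rev t : ℕ) = t := by
        rw [Fin.val_rev]
        omega
      rw [this]
    rw [e1]
    rw [exp_neg_two_mul ρ]
    refine norm_toLp_le_of_geometric ?_ (Real.exp_pos _).le hx1 fun t => ?_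
    · positivity
    · refine (norm_toEuclideanLin_le _ _).trans ?_
      have h1 := (l2_opNorm_mul Bᵀ (Aᵀ ^ (t : ℕ) * Δ * (A - B * K) ^ T)).trans
        (mul_le_mul_of_nonneg_left
          (norm_pow_mul_deviation_mul_pow_le hτ hρ hA hF hP hΔ t T) (norm_nonneg _))
      rw [norm_transpose_eq] at h1
      refine (mul_le_mul_of_nonneg_right h1 (norm_nonneg _)).trans (le_of_eq ?_)
      rw [hx₀n, exp_neg_two_mul, exp_neg_mul_natCast]
      ring
  have hnear := norm_blockPart_neumannSum_le (β := β) hd hM0 hJ0 hγ0 hβ1 (norm_nonneg y)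
    (fun t s => isSED_toeplitzBlock hd hN hγ ha hb hq hr hs hτ hρ hAd hBd hQd hRd hSd hA hP t s)
    j hgb hT k ⟨0, hT⟩ i
  have hfar := norm_sub_neumannSum_le hMs hlam hlamβ hMl hMu hue k
  have hu0 : toEuclideanLin (blockOf K i j) y = blockPart i (u ⟨0, hT⟩) := by
    rw [toEuclideanLin_blockOf]
    simp only [u, pow_zero, Matrix.mul_one]
    rfl
  have hsplit : blockPart i (u ⟨0, hT⟩) = blockPart i (neumannSum M β g k ⟨0, hT⟩) +
      blockPart i ((u - neumannSum M β g k) ⟨0, hT⟩) := by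
    rw [← map_add, ← PiLp.add_apply, add_sub_cancel]
  have h0 : ‖blockPart i ((u - neumannSum M β g k) ⟨0, hT⟩)‖ ≤ ‖u - neumannSum M β g k‖ :=
    (norm_blockPart_le _ _).trans (PiLp.norm_apply_le _ _)
  have h1 : 0 ≤ 1 - lam / β := sub_nonneg.2 ((div_le_one (by linarith)).2 hlamβ)
  have h2 := mul_le_mul_of_nonneg_left (div_le_div_of_nonneg_right hgn hlam.le)
    (pow_nonneg h1 k)
  have h3 := div_le_div_of_nonneg_right hen hlam.le
  rw [hu0, hsplit]
  refine (norm_add_le _ _).trans ((add_le_add hnear (h0.trans hfar)).trans ?_)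
  refine (add_le_add le_rfl (add_le_add h2 h3)).trans (le_of_eq ?_)
  ring

/-- The spatial decay of a gain that solves the Riccati equation. -/
theorem isSED_gain (hd : IsAgentDistance d) (hD : ∀ i j, d i j ≤ D) (hγ : 0 < γsys)
    (ha : 1 ≤ a) (hb : 1 ≤ b) (hq : 1 ≤ q) (hr : 1 ≤ r) (hs : 0 < s)
    (hτ : 1 ≤ τ) (hρ : 0 < ρ) (hQ : Q.PosDef) (hRS : (R - S * Q⁻¹ * Sᵀ).PosDef)
    (hAd : IsSED d A a γsys) (hBd : IsSED d B b γsys) (hQd : IsSED d Q q γsys)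
    (hRd : IsSED d R r γsys) (hSd : IsSED d S s γsys)
    (hA : IsExpStable A τ ρ) (hF : IsExpStable (A - B * K) τ ρ)
    {P' : Matrix (BlockIdx nx) (BlockIdx nx) ℝ}
    (hP' : P' = Q - Sᵀ * K + Aᵀ * P' * (A - B * K))
    (hRK : R * K = S + Bᵀ * P' * (A - B * K)) :
    IsSED d K (constK N b q s τ ρ B Q R S K) (rateK N D γsys a b q r s τ ρ B Q R S) := by
  intro i j
  have hN : 0 < N := Fin.pos i
  have hN1 : (1 : ℝ) ≤ N := by exact_mod_cast hN
  have hw := one_sub_exp_neg_two_mul_pos hρ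
  have hw1 : 1 - Real.exp (-2 * ρ) < 1 := by linarith [Real.exp_pos (-2 * ρ)]
  have hJ0 : 0 ≤ constJ N b q s τ ρ Q S := by unfold constJ; positivity
  -- an agent without controls has an empty block; otherwise `lambdaMin` is a true minimum
  rcases isEmpty_or_nonempty (Fin (nu i)) with hi | ⟨⟨l⟩⟩
  · have h1 : blockOf K i j = 0 := Subsingleton.elim _ _
    have h2 := lambdaMin_nonneg_of_posDef hRS
    rw [h1, norm_zero]
    unfold constK
    positivity
  have hne : Nonempty (BlockIdx nu) := ⟨⟨i, l⟩⟩
  have hlam := lambdaMin_pos_of_posDef hRS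
  set lam := lambdaMin (R - S * Q⁻¹ * Sᵀ) with hlamdef
  set β := max 1 (lambdaMax R + 4 * τ ^ 2 * (‖B‖ ^ 2 * ‖Q‖ + ‖B‖ * ‖S‖) /
    (1 - Real.exp (-2 * ρ)) ^ 2) with hβ
  have hβ1 : 1 ≤ β := le_max_left _ _
  have hlamβ : lam ≤ β := by
    have h1 := lambdaMin_schur_le_lambdaMax hQ hRS
    have h2 : 0 ≤ 4 * τ ^ 2 * (‖B‖ ^ 2 * ‖Q‖ + ‖B‖ * ‖S‖) / (1 - Real.exp (-2 * ρ)) ^ 2 := by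
      positivity
    exact le_trans (by linarith) (le_max_right 1 _)
  set cM := constM N b q r s τ ρ Q S with hcM
  have hcM1 : 1 ≤ cM := by
    have h1 : 0 ≤ b ^ 2 * N ^ 2 * (τ ^ 2 * ‖Q‖ / (1 - Real.exp (-2 * ρ)) + 2 * q) +
      b * N * (s + τ * ‖S‖) := by positivity
    rw [hcM, constM]
    linarith
  set δ := d i j with hδ
  have hδ0 : 0 ≤ δ := hd.nonneg i j
  have hD0 : 0 ≤ D := hδ0.trans (hD i j)
  set Lg := Real.log (γsys * cM * N * D + cM * N + 1) with hLg
  have hcMN : 1 ≤ cM * N := one_le_mul_of_one_le_of_one_le hcM1 hN1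
  have hLg2 : Real.log 2 ≤ Lg := Real.log_le_log (by norm_num) (by
    have : 0 ≤ γsys * cM * N * D := by positivity
    linarith)
  have hLg0 : 0 < Lg := (Real.log_pos one_lt_two).trans_le hLg2
  have hlog : 0 ≤ Real.log (a * N) := Real.log_nonneg (one_le_mul_of_one_le_of_one_le ha hN1)
  have hden : 0 < β * Lg + lam := by positivity
  set γ' := γsys * ρ / (ρ + Real.log (a * N)) with hγ'
  have hγ'0 : 0 ≤ γ' := by positivity
  set γK := rateK N D γsys a b q r s τ ρ B Q R S with hγK
  have hγKe : γK = γsys * ρ * lam / (ρ + Real.log (a * N)) * (1 / (β * Lg + lam)) := rfl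
  have hγK' : γK = γ' * lam / (β * Lg + lam) := by
    rw [hγKe, hγ']
    ring
  have hγK0 : 0 ≤ γK := by rw [hγK']; positivity
  -- `κ` balances `exp (Lg κ - γ' δ)` against `(1 - lam / β) ^ κ`
  set κ := γ' * δ * β / (β * Lg + lam) with hκ
  have hκ0 : 0 ≤ κ := by positivity
  have hκ1 : Lg * κ + -γ' * δ = -γK * δ := by
    rw [hκ, hγK']
    field_simp
    ring
  have hκ2 : lam / β * κ = γK * δ := by
    rw [hκ, hγK']
    field_simp
  -- the shortest horizon with `e ^ (-ρ T) ≤ e ^ (-γK δ)`, up to rounding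
  set T := ⌊γK * δ / ρ⌋₊ + 1 with hT
  have hT0 : 0 < T := Nat.succ_pos _
  have hT1 : (1 : ℝ) ≤ T := by exact_mod_cast hT0
  have hTD : (T : ℝ) ≤ γsys * D + 1 := by
    rw [hT, hγKe]
    refine horizon_le ha hγ hρ hlam hlamβ hLg2 hδ0 (hD i j) ?_
    by_cases hij : i = j
    · exact Or.inl (by rw [hδ, hij, hd.self])
    · have h1 := i.isLt
      have h2 := j.isLt
      have h3 : (i : ℕ) ≠ j := fun h => hij (Fin.ext h)
      exact Or.inr (by omega)
  have hζ1 : 1 ≤ cM * N * T := one_le_mul_of_one_le_of_one_le hcMN hT1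
  have hζL : 1 + cM * N * T ≤ Real.exp Lg := by
    rw [hLg, Real.exp_log (by positivity)]
    have := mul_le_mul_of_nonneg_left hTD (by linarith : 0 ≤ cM * N)
    linarith
  have hmain := norm_blockOf_gain_le hd hγ ha hb hq hr hs hτ hρ hQ hRS hAd hBd hQd hRd hSd hA hF
    hP' hRK hβ1 (le_max_right 1 _) hT0 ⌈κ⌉₊ i j
  rw [← hlamdef, ← hcM, ← hγ', ← hδ] at hmain
  have hE := Real.exp_pos (-γK * δ)
  have hnear : (1 + cM * N * T) ^ ⌈κ⌉₊ / (cM * N * T) * Real.exp (-γ' * δ) ≤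
      2 * Real.exp (-γK * δ) := by
    have h1 := pow_ceil_le (by linarith) hζL hκ0
    have h2 : (1 + cM * N * T) / (cM * N * T) ≤ 2 := by
      rw [div_le_iff₀ (by linarith)]
      linarith
    calc _ ≤ (1 + cM * N * T) * Real.exp (Lg * κ) / (cM * N * T) * Real.exp (-γ' * δ) := by gcongr
      _ = (1 + cM * N * T) / (cM * N * T) * Real.exp (-γK * δ) := by
          rw [← hκ1, Real.exp_add]
          ring
      _ ≤ _ := by gcongr
  have hmid : (1 - lam / β) ^ ⌈κ⌉₊ ≤ Real.exp (-γK * δ) := by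
    refine (one_sub_div_pow_ceil_le hlam.le hlamβ (by linarith)).trans (le_of_eq ?_)
    rw [hκ2, neg_mul]
  have hhor : Real.exp (-ρ * T) ≤ Real.exp (-γK * δ) := by
    rw [Real.exp_le_exp]
    have h1 := (div_lt_iff₀ hρ).1 (Nat.lt_floor_add_one (γK * δ / ρ))
    rw [hT]
    push_cast
    linarith
  set w := 1 - Real.exp (-2 * ρ) with hwdef
  have hG := far_constant_le (b := ‖B‖ * ‖Q‖ + ‖S‖) (τ := τ) hw hw1.le hlam (by positivity)
  have hEe := horizon_constant_le (b := ‖B‖) (q := ‖Q‖) (s := ‖S‖) (k := ‖K‖) (τ := τ) hw hlam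
    (by linarith) (norm_nonneg _) (norm_nonneg _) (norm_nonneg _) (norm_nonneg _)
    (Real.exp_pos _).le hhor
  have h1 := mul_le_mul_of_nonneg_left hnear hJ0
  have h2 : (1 - lam / β) ^ ⌈κ⌉₊ * (τ ^ 2 * (‖B‖ * ‖Q‖ + ‖S‖) / w / √w / lam) ≤
      Real.exp (-γK * δ) * (2 * τ ^ 2 * (‖B‖ * ‖Q‖ + ‖S‖) / (w ^ 2 * lam)) :=
    mul_le_mul hmid hG (by positivity) hE.le
  rw [constK, ← hlamdef, ← hwdef]
  refine hmain.trans ?_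
  rw [add_mul, add_mul]
  linarith

end GainSED

theorem theorem1 {N : ℕ} (nx nu : Fin N → ℕ)
    (d : Fin N → Fin N → ℝ) (hd : IsAgentDistance d) (D : ℝ) (hD : ∀ i j, d i j ≤ D)
    (A : Matrix (BlockIdx nx) (BlockIdx nx) ℝ) (B : Matrix (BlockIdx nx) (BlockIdx nu) ℝ)
    (Q : Matrix (BlockIdx nx) (BlockIdx nx) ℝ) (R : Matrix (BlockIdx nu) (BlockIdx nu) ℝ)
    (S : Matrix (BlockIdx nu) (BlockIdx nx) ℝ)
    (hQ : Q.PosDef) (hRS : (R - S * Q⁻¹ * Sᵀ).PosDef)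
    (γsys a b q r s : ℝ) (hγ : 0 < γsys) (ha : 1 ≤ a) (hb : 1 ≤ b) (hq : 1 ≤ q) (hr : 1 ≤ r)
    (hs : 0 < s)
    (hAd : IsSED d A a γsys) (hBd : IsSED d B b γsys) (hQd : IsSED d Q q γsys)
    (hRd : IsSED d R r γsys) (hSd : IsSED d S s γsys)
    (hA : Tendsto (fun k : ℕ => A ^ k) atTop (𝓝 0))
    {Ω : Type*} [MeasurableSpace Ω] (μ : Measure Ω) [IsProbabilityMeasure μ]
    (w : ℕ → Ω → (BlockIdx nx → ℝ)) (hw : IsStandardGaussianNoise μ w) (x₀ : BlockIdx nx → ℝ)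
    (K : Matrix (BlockIdx nu) (BlockIdx nx) ℝ) (hK : IsOptimalGain μ w x₀ A B Q R S K) :
    (∃ τ ρ : ℝ, 1 ≤ τ ∧ 0 < ρ ∧ IsExpStable A τ ρ ∧ IsExpStable (A - B * K) τ ρ) ∧
    ∀ τ ρ : ℝ, 1 ≤ τ → 0 < ρ → IsExpStable A τ ρ → IsExpStable (A - B * K) τ ρ →
      IsSED d K (constK N b q s τ ρ B Q R S K) (rateK N D γsys a b q r s τ ρ B Q R S) := by
  constructor
  · obtain ⟨τ₁, ρ₁, hτ₁, hρ₁, h₁⟩ := exists_isExpStable hA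
    obtain ⟨τ₂, ρ₂, hτ₂, hρ₂, h₂⟩ := exists_isExpStable (hK.tendsto_pow_zero hw hQ hRS hA)
    exact ⟨max τ₁ τ₂, min ρ₁ ρ₂, hτ₁.trans (le_max_left _ _), lt_min hρ₁ hρ₂,
      h₁.mono (by linarith) (le_max_left _ _) (min_le_left _ _),
      h₂.mono (by linarith) (le_max_right _ _) (min_le_right _ _)⟩
  · intro τ ρ hτ hρ hAs hFs
    obtain ⟨P, hP, hRK⟩ := hK.riccati hw hQ hRS hρ hFs
    exact isSED_gain hd hD hγ ha hb hq hr hs hτ hρ hQ hRS hAd hBd hQd hRd hSd hAs hFs hP hRK
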